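/- Let $\Omega\in\mathbb{R}^{p\times d}$ be a matrix whose rows $\omega_1,\dots,\omega_p$ form a frame of $\mathbb{R}^d$ with upper frame bound $B$, that is, there is a constant $A$ with $0<A\le B<\infty$ such that $$A\|z\|_2^2\le\|\Omega z\|_2^2=\sum_{j=1}^p|\langle\omega_j,z\rangle|^2\le B\|z\|_2^2\qquad\text{for all }z\in\mathbb{R}^d.$$ Let $x\in\mathbb{R}^d$ have cosupport $\Lambda=\{i\in\{1,\dots,p\}:(\Omega x)_i=0\}$. Let $M\in\mathbb{R}^{m\times d}$ be a Gaussian random matrix, i.e. its entries are independent standard normal random variables, and let $\eta\in\mathbb{R}$, $0<\varepsilon<1$ and $\tau>0$. If $$\frac{m^2}{m+1}\ \ge\ \left(\sqrt{\,d-\frac{2}{\pi}\,\frac{\left(\sum_{i\in\Lambda}\|\omega_i\|_2\right)^2}{pB}\,}+\sqrt{2\ln(\varepsilon^{-1})}+\tau\right)^2,$$ then, with probability at least $1-\varepsilon$ over the draw of $M$, the following holds: for every noise vector $w\in\mathbb{R}^m$ with $\|w\|_2\le\eta$ and noisy measurements $y=Mx+w$, any minimizer $\hat x$ of the analysis $\ell_1$-minimization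 problem $$\min_{z\in\mathbb{R}^d}\|\Omega z\|_1\quad\text{subject to}\quad\|Mz-y\|_2\le\eta$$ satisfies $$\|x-\hat x\|_2\le\frac{2\eta}{\tau}.$$ (In the degenerate case $p=0$, which forces $d=0$, the fraction under the root is read as $0$.) -/

import Mathlib

open MeasureTheory ProbabilityTheory

noncomputable section

/-- The image `Ω z` of a vector `z` under a real matrix `Ω`, with Euclidean norms on both sides. -/
def matApply {k n : ℕ} (Ω : Matrix (Fin k) (Fin n) ℝ) (z : EuclideanSpace ℝ (Fin n)) :
    EuclideanSpace ℝ (Fin k) :=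
  WithLp.toLp 2 (Ω.mulVec z.ofLp)

/-- The `j`-th row of `Ω`, as a vector of Euclidean space. -/
def matRow {k n : ℕ} (Ω : Matrix (Fin k) (Fin n) ℝ) (j : Fin k) : EuclideanSpace ℝ (Fin n) :=
  WithLp.toLp 2 (Ω j)

/-- The `ℓ₁`-norm of a vector. -/
def l1Norm {k : ℕ} (v : EuclideanSpace ℝ (Fin k)) : ℝ := ∑ i, |v i|

/-- The rows of `Ω` form a frame with lower frame bound `A` and upper frame bound `B`. -/
structure IsFrameWithBounds {p d : ℕ} (Ω : Matrix (Fin p) (Fin d) ℝ) (A B : ℝ) : Prop where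
  lower_pos : 0 < A
  lower_le_upper : A ≤ B
  lower_bound : ∀ z : EuclideanSpace ℝ (Fin d),
    A * ‖z‖ ^ 2 ≤ ∑ j, |inner ℝ (matRow Ω j) z| ^ 2
  upper_bound : ∀ z : EuclideanSpace ℝ (Fin d),
    ∑ j, |inner ℝ (matRow Ω j) z| ^ 2 ≤ B * ‖z‖ ^ 2

/-- The cosupport of `x` with respect to `Ω`: the set of the indices of the zero entries
of `Ω x`. -/
def cosupport {p d : ℕ} (Ω : Matrix (Fin p) (Fin d) ℝ) (x : EuclideanSpace ℝ (Fin d)) :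
    Finset (Fin p) :=
  {i | matApply Ω x i = 0}

/-- `xhat` minimizes `‖Ω z‖₁` among all `z` with `‖M z - y‖₂ ≤ η`. -/
def IsAnalysisL1Minimizer {p d m : ℕ} (Ω : Matrix (Fin p) (Fin d) ℝ)
    (M : Matrix (Fin m) (Fin d) ℝ) (y : EuclideanSpace ℝ (Fin m)) (η : ℝ)
    (xhat : EuclideanSpace ℝ (Fin d)) : Prop :=
  ‖matApply M xhat - y‖ ≤ η ∧
    ∀ z : EuclideanSpace ℝ (Fin d), ‖matApply M z - y‖ ≤ η →
      l1Norm (matApply Ω xhat) ≤ l1Norm (matApply Ω z)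

/-- A Gaussian random matrix: its entries are independent standard normal random variables. -/
structure IsGaussianMatrix {S : Type*} [MeasurableSpace S] (P : Measure S) {m d : ℕ}
    (M : S → Matrix (Fin m) (Fin d) ℝ) : Prop where
  hasLaw : ∀ i j, HasLaw (fun s => M s i j) (gaussianReal 0 1) P
  indep : iIndepFun (fun (ij : Fin m × Fin d) (s : S) => M s ij.1 ij.2) P

end

/-! Both `x` and a minimizer `xhat` are feasible, so `M` maps `xhat - x` to a vector of norm at most
`2η`. Minimality makes `xhat - x` a descent direction of `z ↦ ‖Ω z‖₁` at `x`. A bound `‖M v‖ ≥ τ` on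
`descentSphere Ω x` therefore gives the error estimate (`norm_sub_minimizer_le`), and it remains to
prove this bound with probability at least `1 - ε`.

Gordon's comparison is obtained by interpolation. For unit vectors `v k` and independent standard
Gaussian `M`, `g`, `h`, the process `‖sin θ • M v + cos θ • g‖ - cos θ * ⟪h, v⟫` runs from `‖g‖ -
⟪h, v⟫` at `θ = 0` to `‖M v‖` at `θ = π / 2`. Norm and minimum are replaced by `smoothNorm` and
`softMin`. The expectation of the soft minimum is differentiated in `θ` under the weight `exp (-lam
* softMin)` taken at the endpoint `π / 2`. Stein's identity turns the derivative into an explicit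
expression bounded below by `-lam * cos θ` times the weight (`gordon_pointwise`). Integration over
`θ` yields `gordon_laplace`, a differential inequality in `lam` for the Laplace transform of the
minimum. Solving it gives a sub-Gaussian lower tail directly, so comparison and concentration come
in one step (`integral_laplaceWeight_le`, `gordon_escape_finite`).

Two expectations then matter. Stein's identity gives `E‖g‖ ≥ m / √(m + 1)`
(`le_integral_smoothNorm`). The supremum of `⟪h, v⟫` over the descent sphere is at most the distance
from `h` to any multiple `t • w`, `t ≥ 0`, of a vector `w` in the polar cone. The choice `w = Ωᵀ σ`,
with signs `σ` adapted to `h` on the cosupport, has `‖w‖² ≤ p * B` and correlates with `h`;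
optimizing `t` produces the square root in the hypothesis (`exists_width_majorant`). -/

noncomputable section

open Real Set Filter Topology

/-! ### Gaussian integration by parts -/

/-- The standard Gaussian measure on `ι → ℝ`. -/
abbrev gaussPi (ι : Type*) [Fintype ι] : Measure (ι → ℝ) :=
  Measure.pi (fun _ : ι => gaussianReal 0 1)

lemma hasDerivAt_gaussianPDFReal_std (t : ℝ) :
    HasDerivAt (gaussianPDFReal 0 1) (-t * gaussianPDFReal 0 1 t) t := by
  have h : gaussianPDFReal 0 1 = fun x => (√(2 * π))⁻¹ * rexp (-x ^ 2 / 2) := by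
    ext x; simp [gaussianPDFReal]
  rw [h]
  have h1 : HasDerivAt (fun x : ℝ => -x ^ 2 / 2) (-t) t :=
    (((hasDerivAt_pow 2 t).fun_neg).div_const 2).congr_deriv (by simp; ring)
  exact (h1.exp.const_mul (√(2 * π))⁻¹).congr_deriv (by ring)

lemma integrable_gaussianReal_iff_std (f : ℝ → ℝ) :
    Integrable f (gaussianReal 0 1) ↔ Integrable (fun x => gaussianPDFReal 0 1 x * f x) := by
  rw [gaussianReal_of_var_ne_zero _ one_ne_zero,
    integrable_withDensity_iff_integrable_smul₀' (measurable_gaussianPDF _ _).aemeasurable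
      (ae_of_all _ fun _ => gaussianPDF_lt_top)]
  simp [smul_eq_mul]

/-- Stein's identity on the line. -/
lemma integral_stein {f f' : ℝ → ℝ} (hf : ∀ t, HasDerivAt f (f' t) t)
    (hi : Integrable f (gaussianReal 0 1)) (hi' : Integrable f' (gaussianReal 0 1))
    (hx : Integrable (fun t => t * f t) (gaussianReal 0 1)) :
    ∫ t, (t * f t - f' t) ∂(gaussianReal 0 1) = 0 := by
  rw [integral_gaussianReal_eq_integral_smul one_ne_zero]
  rw [integrable_gaussianReal_iff_std] at hi hi' hx
  -- The density satisfies `φ' = -t φ`, so the integrand is minus the derivative of `φ f`, whose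
  -- integral over the line vanishes.
  have h := integral_eq_zero_of_hasDerivAt_of_integrable
    (f := fun t => gaussianPDFReal 0 1 t * f t)
    (f' := fun t => (-t * gaussianPDFReal 0 1 t) * f t + gaussianPDFReal 0 1 t * f' t)
    (fun t => (hasDerivAt_gaussianPDFReal_std t).mul (hf t))
    ((hx.neg.add hi').congr (ae_of_all _ fun t => by simp; ring)) hi
  rw [← neg_eq_zero, ← integral_neg]
  refine (integral_congr_ae (ae_of_all _ fun t => ?_)).trans h
  simp only [smul_eq_mul]; ring

section GaussianMeasure

variable {ι : Type*} [Fintype ι]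

/-- Resampling one coordinate independently leaves a product measure unchanged. This allows Fubini
in a single coordinate without splitting the index type. -/
lemma measurePreserving_update [DecidableEq ι] (c : ι) :
    MeasurePreserving (fun q : (ι → ℝ) × ℝ => Function.update q.1 c q.2)
      ((gaussPi ι).prod (gaussianReal 0 1)) (gaussPi ι) := by
  have hm : Measurable (fun q : (ι → ℝ) × ℝ => Function.update q.1 c q.2) := by
    refine measurable_pi_iff.2 fun i => ?_
    by_cases h : i = c
    · subst h; simpa using measurable_snd
    · simpa [h, Function.comp_def] using (measurable_pi_apply i).comp (measurable_fst (α := ι → ℝ) (β := ℝ))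
  refine ⟨hm, (Measure.pi_eq fun s hs => ?_).symm⟩
  rw [Measure.map_apply hm (.univ_pi hs)]
  have : (fun q : (ι → ℝ) × ℝ => Function.update q.1 c q.2) ⁻¹' (univ.pi s)
      = (univ.pi (Function.update s c univ)) ×ˢ (s c) := by
    ext q
    simp only [mem_preimage, Set.mem_pi, mem_univ, true_imp_iff, mem_prod]
    constructor
    · intro h
      refine ⟨fun i => ?_, by simpa using h c⟩
      by_cases hi : i = c
      · subst hi; simp
      · simpa [hi] using h i
    · rintro ⟨h1, h2⟩ i
      by_cases hi : i = c
      · subst hi; simpa using h2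
      · simpa [hi] using h1 i
  rw [this, Measure.prod_prod, Measure.pi_pi, ← Finset.mul_prod_erase _ _ (Finset.mem_univ c),
    ← Finset.mul_prod_erase Finset.univ (fun i => gaussianReal 0 1 (s i)) (Finset.mem_univ c)]
  simp only [Function.update_self, measure_univ, one_mul]
  rw [mul_comm]
  congr 1
  refine Finset.prod_congr rfl fun i hi => ?_
  rw [Function.update_of_ne (Finset.ne_of_mem_erase hi)]

lemma hasDerivAt_update_of_hasDerivAt_add_smul {ι : Type*} [DecidableEq ι] {f f' : (ι → ℝ) → ℝ} {c : ι}
    (hf : ∀ x, HasDerivAt (fun s : ℝ => f (x + s • Pi.single c 1)) (f' x) 0) (x : ι → ℝ) (t : ℝ) :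
    HasDerivAt (fun s : ℝ => f (Function.update x c s)) (f' (Function.update x c t)) t := by
  have h := hf (Function.update x c t)
  rw [show (0 : ℝ) = t - t by ring] at h
  have h2 := h.comp_sub_const t t
  refine h2.congr_of_eventuallyEq (Eventually.of_forall fun s => ?_)
  simp only
  congr 1
  ext i
  by_cases hi : i = c
  · subst hi; simp
  · simp [hi]

/-- Stein's identity for a partial derivative. -/
lemma integral_stein_pi [DecidableEq ι] {f f' : (ι → ℝ) → ℝ} (c : ι)
    (hf : ∀ x, HasDerivAt (fun s : ℝ => f (x + s • Pi.single c 1)) (f' x) 0)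
    (hi : Integrable f (gaussPi ι)) (hi' : Integrable f' (gaussPi ι))
    (hx : Integrable (fun x => x c * f x) (gaussPi ι)) :
    ∫ x, x c * f x ∂(gaussPi ι) = ∫ x, f' x ∂(gaussPi ι) := by
  rw [← sub_eq_zero, ← integral_sub hx hi']
  have mp := measurePreserving_update (ι := ι) c
  have key : ∀ {g : (ι → ℝ) → ℝ}, Integrable g (gaussPi ι) →
      Integrable (fun q : (ι → ℝ) × ℝ => g (Function.update q.1 c q.2))
        ((gaussPi ι).prod (gaussianReal 0 1)) := fun hg => mp.integrable_comp_of_integrable hg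
  rw [← mp.map_eq, integral_map mp.aemeasurable
    (by rw [mp.map_eq]; exact (hx.sub hi').aestronglyMeasurable),
    integral_prod _ (by simpa using! key (hx.sub hi'))]
  apply integral_eq_zero_of_ae
  filter_upwards [(key hi).prod_right_ae, (key hi').prod_right_ae, (key hx).prod_right_ae]
    with x h1 h2 h3
  simp only [Function.update_self] at h3 ⊢
  exact integral_stein (hasDerivAt_update_of_hasDerivAt_add_smul hf x) h1 h2 h3

lemma memLp_gaussPi_apply (c : ι) (q : NNReal) : MemLp (fun x : ι → ℝ => x c) q (gaussPi ι) :=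
  (memLp_id_gaussianReal q).comp_measurePreserving
    (measurePreserving_eval (fun _ : ι => gaussianReal 0 1) c)

lemma integrable_gaussPi_apply (c : ι) : Integrable (fun x : ι → ℝ => x c) (gaussPi ι) :=
  memLp_one_iff_integrable.1 (by simpa using memLp_gaussPi_apply c 1)

lemma integral_gaussPi_sq (c : ι) : ∫ x, x c ^ 2 ∂(gaussPi ι) = 1 := by
  classical
  have h := integral_stein_pi (f := fun x => x c) (f' := fun _ => 1) c
    (fun x => by
      have : HasDerivAt (fun s : ℝ => x c + s) 1 0 := (hasDerivAt_id (0 : ℝ)).const_add (x c)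
      simpa using this) (integrable_gaussPi_apply c) (integrable_const _)
    (by simpa [sq] using (by simpa using memLp_gaussPi_apply c 2 :
      MemLp (fun x : ι → ℝ => x c) 2 (gaussPi ι)).integrable_sq)
  simpa [sq] using h

/-- A continuous function of at most linear growth is square integrable for the Gaussian measure. -/
lemma memLp_two_gaussPi_of_le {f : (ι → ℝ) → ℝ} (hf : AEStronglyMeasurable f (gaussPi ι)) {C D : ℝ}
    (h : ∀ x, |f x| ≤ C + D * ∑ c, |x c|) : MemLp f 2 (gaussPi ι) := by
  have : MemLp (fun x : ι → ℝ => C + D * ∑ c, |x c|) 2 (gaussPi ι) := by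
    refine MemLp.add (f := fun _ => C) (memLp_const C) (MemLp.const_mul
      (memLp_finsetSum (f := fun c (x : ι → ℝ) => |x c|) _ fun c _ => ?_) D)
    exact (by simpa using memLp_gaussPi_apply c 2 :
      MemLp (fun x : ι → ℝ => x c) 2 (gaussPi ι)).abs
  exact this.mono hf (ae_of_all _ fun x => by
    simpa using (h x).trans (le_abs_self _))

lemma integrable_gaussPi_of_le {f : (ι → ℝ) → ℝ} (hf : AEStronglyMeasurable f (gaussPi ι)) {C D : ℝ}
    (h : ∀ x, |f x| ≤ C + D * ∑ c, |x c|) : Integrable f (gaussPi ι) :=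
  (memLp_two_gaussPi_of_le hf h).integrable (by norm_num)

/-- A bounded continuous function. -/
def IsBddCont {X : Type*} [TopologicalSpace X] (f : X → ℝ) : Prop :=
  Continuous f ∧ ∃ C, ∀ x, |f x| ≤ C

namespace IsBddCont

variable {X : Type*} [TopologicalSpace X] {f g : X → ℝ}

lemma const (a : ℝ) : IsBddCont (fun _ : X => a) := ⟨continuous_const, |a|, fun _ => le_rfl⟩

lemma add (hf : IsBddCont f) (hg : IsBddCont g) : IsBddCont (fun x => f x + g x) := by
  obtain ⟨hf, C, hC⟩ := hf
  obtain ⟨hg, D, hD⟩ := hg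
  exact ⟨hf.add hg, C + D, fun x => (abs_add_le _ _).trans (add_le_add (hC x) (hD x))⟩

lemma neg (hf : IsBddCont f) : IsBddCont (fun x => - f x) := by
  obtain ⟨hf, C, hC⟩ := hf
  exact ⟨hf.neg, C, fun x => by simpa using hC x⟩

lemma sub (hf : IsBddCont f) (hg : IsBddCont g) : IsBddCont (fun x => f x - g x) := by
  simpa [sub_eq_add_neg] using hf.add hg.neg

lemma mul (hf : IsBddCont f) (hg : IsBddCont g) : IsBddCont (fun x => f x * g x) := by
  obtain ⟨hf, C, hC⟩ := hf
  obtain ⟨hg, D, hD⟩ := hg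
  refine ⟨hf.mul hg, C * D, fun x => ?_⟩
  rw [abs_mul]
  exact mul_le_mul (hC x) (hD x) (abs_nonneg _) ((abs_nonneg _).trans (hC x))

lemma sum {κ : Type*} (s : Finset κ) {f : κ → X → ℝ} (hf : ∀ k, IsBddCont (f k)) :
    IsBddCont (fun x => ∑ k ∈ s, f k x) := by
  classical
  induction s using Finset.induction_on with
  | empty => simpa using const (X := X) 0
  | insert a s ha ih => simpa [Finset.sum_insert ha] using (hf a).add ih

lemma integrable {ι : Type*} [Fintype ι] {f : (ι → ℝ) → ℝ} (hf : IsBddCont f) :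
    Integrable f (gaussPi ι) := by
  obtain ⟨hf, C, hC⟩ := hf
  exact integrable_gaussPi_of_le hf.aestronglyMeasurable (C := C) (D := 0)
    (fun x => by simpa using hC x)

lemma integrable_mul_apply {ι : Type*} [Fintype ι] {f : (ι → ℝ) → ℝ} (hf : IsBddCont f) (c : ι) :
    Integrable (fun x => x c * f x) (gaussPi ι) := by
  obtain ⟨hf, C, hC⟩ := hf
  refine integrable_gaussPi_of_le ((continuous_apply c).mul hf).aestronglyMeasurable
    (C := 0) (D := C) (fun x => ?_)
  rw [abs_mul, zero_add, mul_comm]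
  exact mul_le_mul (hC x) (Finset.single_le_sum (f := fun c => |x c|) (fun _ _ => abs_nonneg _)
    (Finset.mem_univ c)) (abs_nonneg _) ((abs_nonneg _).trans (hC x))

end IsBddCont

lemma integral_stein_of_isBddCont [DecidableEq ι] {f f' : (ι → ℝ) → ℝ} (c : ι)
    (hf : ∀ x, HasDerivAt (fun s : ℝ => f (x + s • Pi.single c 1)) (f' x) 0)
    (hi : IsBddCont f) (hi' : IsBddCont f') :
    ∫ x, x c * f x ∂(gaussPi ι) = ∫ x, f' x ∂(gaussPi ι) :=
  integral_stein_pi c hf hi.integrable hi'.integrable (hi.integrable_mul_apply c)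

end GaussianMeasure

/-! ### A smooth surrogate for the Euclidean norm -/

section SmoothNorm

variable {α : Type*} [Fintype α]

/-- A smooth approximation of the Euclidean norm from above. -/
def smoothNorm (δ : ℝ) (y : α → ℝ) : ℝ := √(δ ^ 2 + ∑ i, y i ^ 2)

variable {δ : ℝ}

lemma smoothNorm_sq (δ : ℝ) (y : α → ℝ) : smoothNorm δ y ^ 2 = δ ^ 2 + ∑ i, y i ^ 2 :=
  sq_sqrt (by positivity)

lemma le_smoothNorm (δ : ℝ) (y : α → ℝ) : δ ≤ smoothNorm δ y :=
  le_sqrt_of_sq_le (le_add_of_nonneg_right (by positivity))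

lemma smoothNorm_pos (hδ : 0 < δ) (y : α → ℝ) : 0 < smoothNorm δ y :=
  hδ.trans_le (le_smoothNorm δ y)

lemma smoothNorm_le_add_sqrt (hδ : 0 < δ) (y : α → ℝ) :
    smoothNorm δ y ≤ δ + √(∑ i, y i ^ 2) := by
  have h : 0 ≤ ∑ i, y i ^ 2 := by positivity
  refine sqrt_le_iff.2 ⟨by positivity, ?_⟩
  nlinarith [sq_sqrt h, sqrt_nonneg (∑ i, y i ^ 2)]

lemma smoothNorm_le_add_sum (hδ : 0 < δ) (y : α → ℝ) : smoothNorm δ y ≤ δ + ∑ i, |y i| := by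
  refine (smoothNorm_le_add_sqrt hδ y).trans (add_le_add_right ?_ _)
  refine sqrt_le_iff.2 ⟨by positivity, ?_⟩
  simpa using Finset.sum_sq_le_sq_sum_of_nonneg (s := Finset.univ) (f := fun i => |y i|)
    (fun i _ => abs_nonneg _)

lemma sum_sq_div_smoothNorm_le_one (hδ : 0 < δ) (y : α → ℝ) :
    ∑ i, (y i / smoothNorm δ y) ^ 2 ≤ 1 := by
  have h := smoothNorm_pos hδ y
  simp_rw [div_pow, ← Finset.sum_div]
  rw [div_le_one (by positivity), smoothNorm_sq]
  nlinarith

lemma abs_div_smoothNorm_le_one (hδ : 0 < δ) (y : α → ℝ) (i : α) :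
    |y i / smoothNorm δ y| ≤ 1 := by
  rw [← sq_le_one_iff_abs_le_one]
  exact (Finset.single_le_sum (f := fun i => (y i / smoothNorm δ y) ^ 2)
    (fun _ _ => sq_nonneg _) (Finset.mem_univ i)).trans (sum_sq_div_smoothNorm_le_one hδ y)

@[fun_prop]
lemma continuous_smoothNorm (δ : ℝ) : Continuous (smoothNorm (α := α) δ) := by
  unfold smoothNorm; fun_prop

lemma HasDerivAt.smoothNorm (hδ : 0 < δ) {y : ℝ → α → ℝ} {y' : α → ℝ} {t : ℝ}
    (hy : ∀ i, HasDerivAt (fun s => y s i) (y' i) t) :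
    HasDerivAt (fun s => smoothNorm δ (y s)) (∑ i, y t i / smoothNorm δ (y t) * y' i) t := by
  have h1 : HasDerivAt (fun s => δ ^ 2 + ∑ i, y s i ^ 2) (∑ i, 2 * y t i * y' i) t := by
    refine HasDerivAt.const_add _ (HasDerivAt.fun_sum fun i _ => ?_)
    simpa using (hy i).fun_pow 2
  refine (h1.sqrt (by positivity)).congr_deriv ?_
  rw [Finset.sum_div]
  refine Finset.sum_congr rfl fun i _ => ?_
  change _ / (2 * _root_.smoothNorm δ (y t)) = _
  have := (smoothNorm_pos hδ (y t)).ne'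
  field_simp

lemma HasDerivAt.div_smoothNorm (hδ : 0 < δ) {y : ℝ → α → ℝ} {y' : α → ℝ} {t : ℝ}
    (hy : ∀ i, HasDerivAt (fun s => y s i) (y' i) t) (i : α) :
    HasDerivAt (fun s => y s i / _root_.smoothNorm δ (y s))
      ((y' i - y t i / _root_.smoothNorm δ (y t)
        * ∑ j, y t j / _root_.smoothNorm δ (y t) * y' j) * (_root_.smoothNorm δ (y t))⁻¹) t := by
  have := (smoothNorm_pos hδ (y t)).ne'
  refine ((hy i).div (HasDerivAt.smoothNorm hδ hy) this).congr_deriv ?_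
  field_simp

end SmoothNorm

/-! ### The soft minimum and its Gibbs weights -/

section SoftMin

variable {κ : Type*} [Fintype κ]

/-- The soft minimum at inverse temperature `β`. -/
def softMin (β : ℝ) (a : κ → ℝ) : ℝ := -(Real.log (∑ k, rexp (-β * a k)) / β)

/-- The gradient of the soft minimum. -/
def gibbs (β : ℝ) (a : κ → ℝ) (k : κ) : ℝ := rexp (-β * a k) / ∑ l, rexp (-β * a l)

lemma gibbs_nonneg (β : ℝ) (a : κ → ℝ) (k : κ) : 0 ≤ gibbs β a k := by
  unfold gibbs; positivity

variable [Nonempty κ] {β : ℝ}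

lemma sum_exp_pos (β : ℝ) (a : κ → ℝ) : 0 < ∑ l, rexp (-β * a l) :=
  Finset.sum_pos (fun _ _ => exp_pos _) Finset.univ_nonempty

lemma sum_gibbs (β : ℝ) (a : κ → ℝ) : ∑ k, gibbs β a k = 1 := by
  unfold gibbs
  rw [← Finset.sum_div, div_self (sum_exp_pos β a).ne']

lemma gibbs_le_one (β : ℝ) (a : κ → ℝ) (k : κ) : gibbs β a k ≤ 1 := by
  rw [← sum_gibbs β a]
  exact Finset.single_le_sum (f := gibbs β a) (fun l _ => gibbs_nonneg β a l) (Finset.mem_univ k)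

lemma continuous_softMin (β : ℝ) : Continuous (softMin (κ := κ) β) := by
  unfold softMin
  exact ((Continuous.log (by fun_prop) fun a => (sum_exp_pos β a).ne').div_const _).neg

lemma continuous_gibbs (β : ℝ) (k : κ) : Continuous (fun a => gibbs (κ := κ) β a k) := by
  unfold gibbs
  exact Continuous.div (by fun_prop) (by fun_prop) fun a => (sum_exp_pos β a).ne'

lemma softMin_le (hβ : 0 < β) (a : κ → ℝ) (k : κ) : softMin β a ≤ a k := by
  unfold softMin
  rw [neg_le, le_div_iff₀ hβ, le_log_iff_exp_le (sum_exp_pos β a),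
    show -a k * β = -β * a k by ring]
  exact Finset.single_le_sum (f := fun k => rexp (-β * a k)) (fun _ _ => (exp_pos _).le)
    (Finset.mem_univ k)

/-- Each of the `card κ` exponentials is at most `exp (-β c)`; the logarithm of the cardinality is
the only loss, and it vanishes as `β → ∞`. -/
lemma le_softMin (hβ : 0 < β) {a : κ → ℝ} {c : ℝ} (h : ∀ k, c ≤ a k) :
    c - Real.log (Fintype.card κ) / β ≤ softMin β a := by
  unfold softMin
  have hc : (0 : ℝ) < Fintype.card κ := by exact_mod_cast Fintype.card_pos
  have : ∑ k, rexp (-β * a k) ≤ Fintype.card κ * rexp (-β * c) := by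
    rw [← nsmul_eq_mul]
    exact Finset.sum_le_card_nsmul _ _ _ fun k _ => exp_le_exp.2 (by nlinarith [h k])
  have h2 := log_le_log (sum_exp_pos β a) this
  rw [log_mul hc.ne' (exp_pos _).ne', log_exp] at h2
  rw [le_neg, div_le_iff₀ hβ]
  have : (-(c - Real.log (Fintype.card κ) / β)) * β = Real.log (Fintype.card κ) + -β * c := by
    field_simp; ring
  rwa [this]

lemma abs_softMin_le (hβ : 0 < β) (a : κ → ℝ) :
    |softMin β a| ≤ Real.log (Fintype.card κ) / β + ∑ k, |a k| := by
  have hk : ∀ k, |a k| ≤ ∑ k, |a k| := fun k =>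
    Finset.single_le_sum (f := fun k => |a k|) (fun _ _ => abs_nonneg _) (Finset.mem_univ k)
  have h0 : 0 ≤ Real.log (Fintype.card κ) / β :=
    div_nonneg (log_natCast_nonneg _) hβ.le
  obtain ⟨k⟩ := ‹Nonempty κ›
  rw [abs_le]
  constructor
  · have := le_softMin hβ (a := a) (c := -∑ k, |a k|) fun k => (abs_le.1 (hk k)).1
    linarith
  · linarith [softMin_le hβ a k, (abs_le.1 (hk k)).2]

lemma HasDerivAt.softMin (hβ : 0 < β) {a : ℝ → κ → ℝ} {a' : κ → ℝ} {t : ℝ}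
    (ha : ∀ k, HasDerivAt (fun s => a s k) (a' k) t) :
    HasDerivAt (fun s => softMin β (a s)) (∑ k, gibbs β (a t) k * a' k) t := by
  have h1 : HasDerivAt (fun s => ∑ k, rexp (-β * a s k))
      (∑ k, rexp (-β * a t k) * (-β * a' k)) t :=
    HasDerivAt.fun_sum fun k _ => ((ha k).const_mul (-β)).exp
  have hp := (sum_exp_pos β (a t)).ne'
  refine ((h1.log hp).div_const β).fun_neg.congr_deriv ?_
  unfold gibbs
  rw [Finset.sum_div, Finset.sum_div, ← Finset.sum_neg_distrib]
  refine Finset.sum_congr rfl fun k _ => ?_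
  field_simp

lemma HasDerivAt.gibbs {a : ℝ → κ → ℝ} {a' : κ → ℝ} {t : ℝ}
    (ha : ∀ k, HasDerivAt (fun s => a s k) (a' k) t) (k : κ) :
    HasDerivAt (fun s => gibbs β (a s) k)
      (-β * gibbs β (a t) k * (a' k - ∑ l, _root_.gibbs β (a t) l * a' l)) t := by
  have h1 : HasDerivAt (fun s => ∑ k, rexp (-β * a s k))
      (∑ k, rexp (-β * a t k) * (-β * a' k)) t :=
    HasDerivAt.fun_sum fun k _ => ((ha k).const_mul (-β)).exp
  have hp := (sum_exp_pos β (a t)).ne'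
  refine (((ha k).const_mul (-β)).exp.div h1 hp).congr_deriv ?_
  -- Factoring out the partition function exhibits the Gibbs average of `a'`, so that the derivative
  -- takes the centred form `a' k` minus its mean.
  have e1 : ∑ k, rexp (-β * a t k) * (-β * a' k)
      = -β * (∑ k, rexp (-β * a t k)) * ∑ l, _root_.gibbs β (a t) l * a' l := by
    rw [Finset.mul_sum]
    refine Finset.sum_congr rfl fun l _ => ?_
    unfold _root_.gibbs
    field_simp
  rw [e1]
  generalize ∑ l, _root_.gibbs β (a t) l * a' l = T
  unfold _root_.gibbs
  field_simp
  ring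

end SoftMin

/-! ### The interpolating process and its derivatives -/

section Field

variable {α b κ : Type*} [Fintype b]

/-- The vectors `sin θ • M v + cos θ • g`, where `x` encodes the triple `(M, g, h)`. -/
def fieldVec (v : κ → b → ℝ) (θ : ℝ) (x : (α × b) ⊕ (α ⊕ b) → ℝ) (k : κ) (i : α) : ℝ :=
  sin θ * ∑ j, x (.inl (i, j)) * v k j + cos θ * x (.inr (.inl i))

/-- The process `‖sin θ • M v + cos θ • g‖ - cos θ * ⟪h, v⟫` with smoothed norm. -/
def fieldVal [Fintype α] (δ : ℝ) (v : κ → b → ℝ) (θ : ℝ) (x : (α × b) ⊕ (α ⊕ b) → ℝ) (k : κ) : ℝ :=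
  smoothNorm δ (fieldVec v θ x k) - cos θ * ∑ j, x (.inr (.inr j)) * v k j

/-- The smoothed direction of `fieldVec`. -/
def fieldDir [Fintype α] (δ : ℝ) (v : κ → b → ℝ) (θ : ℝ) (x : (α × b) ⊕ (α ⊕ b) → ℝ) (k : κ) (i : α) : ℝ :=
  fieldVec v θ x k i / smoothNorm δ (fieldVec v θ x k)

/-- The derivative of `fieldVal` at `x` in the direction `u`. -/
def fieldValDeriv [Fintype α] (δ : ℝ) (v : κ → b → ℝ) (θ : ℝ) (x u : (α × b) ⊕ (α ⊕ b) → ℝ) (k : κ) : ℝ :=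
  ∑ i, fieldDir δ v θ x k i * fieldVec v θ u k i - cos θ * ∑ j, u (.inr (.inr j)) * v k j

variable {δ : ℝ} {v : κ → b → ℝ}

lemma continuous_fieldVec (v : κ → b → ℝ) (θ : ℝ) (k : κ) :
    Continuous (fun x : (α × b) ⊕ (α ⊕ b) → ℝ => fieldVec v θ x k) := by
  unfold fieldVec; fun_prop

lemma hasDerivAt_fieldVec_line (v : κ → b → ℝ) (θ : ℝ) (x u : (α × b) ⊕ (α ⊕ b) → ℝ) (k : κ)
    (i : α) : HasDerivAt (fun s : ℝ => fieldVec v θ (x + s • u) k i) (fieldVec v θ u k i) 0 := by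
  have h : (fun s : ℝ => fieldVec v θ (x + s • u) k i)
      = fun s => fieldVec v θ x k i + s * fieldVec v θ u k i := by
    ext s
    simp only [fieldVec, Pi.add_apply, Pi.smul_apply, smul_eq_mul, add_mul,
      Finset.sum_add_distrib, mul_assoc, ← Finset.mul_sum]
    ring
  rw [h]
  simpa using ((hasDerivAt_id (0 : ℝ)).mul_const (fieldVec v θ u k i)).const_add
    (fieldVec v θ x k i)

lemma hasDerivAt_fieldVec_angle (v : κ → b → ℝ) (θ : ℝ) (x : (α × b) ⊕ (α ⊕ b) → ℝ) (k : κ)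
    (i : α) : HasDerivAt (fun s : ℝ => fieldVec v s x k i)
      (cos θ * ∑ j, x (.inl (i, j)) * v k j - sin θ * x (.inr (.inl i))) θ :=
  (((hasDerivAt_sin θ).mul_const _).add ((hasDerivAt_cos θ).mul_const _)).congr_deriv (by ring)

section Single

variable [DecidableEq α] [DecidableEq b]

lemma fieldVec_single_matrix (v : κ → b → ℝ) (θ : ℝ) (i : α) (j : b) (k : κ) (i' : α) :
    fieldVec v θ (Pi.single (.inl (i, j)) 1) k i' = if i' = i then sin θ * v k j else 0 := by
  by_cases h : i' = i
  · subst h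
    simp [fieldVec, Pi.single_apply]
  · simp [fieldVec, h]

lemma fieldVec_single_left (v : κ → b → ℝ) (θ : ℝ) (i : α) (k : κ) (i' : α) :
    fieldVec v θ (Pi.single (.inr (.inl i)) 1) k i' = if i' = i then cos θ else 0 := by
  simp [fieldVec, Pi.single_apply]

lemma fieldVec_single_right (v : κ → b → ℝ) (θ : ℝ) (j : b) (k : κ) (i' : α) :
    fieldVec v θ (Pi.single (.inr (.inr j)) 1) k i' = 0 := by
  simp [fieldVec]

end Single

variable [Fintype α]

lemma continuous_fieldVal (δ : ℝ) (v : κ → b → ℝ) (θ : ℝ) :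
    Continuous (fun x : (α × b) ⊕ (α ⊕ b) → ℝ => fieldVal δ v θ x) := by
  refine continuous_pi fun k => ?_
  unfold fieldVal
  exact ((continuous_smoothNorm δ).comp (continuous_fieldVec v θ k)).sub (by fun_prop)

lemma isBddCont_fieldDir (hδ : 0 < δ) (θ : ℝ) (k : κ) (i : α) :
    IsBddCont (fun x : (α × b) ⊕ (α ⊕ b) → ℝ => fieldDir δ v θ x k i) :=
  ⟨((continuous_apply i).comp (continuous_fieldVec v θ k)).div
    ((continuous_smoothNorm δ).comp (continuous_fieldVec v θ k))
    fun _ => (smoothNorm_pos hδ _).ne', 1, fun _ => abs_div_smoothNorm_le_one hδ _ i⟩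

lemma isBddCont_inv_smoothNorm (hδ : 0 < δ) (θ : ℝ) (k : κ) :
    IsBddCont (fun x : (α × b) ⊕ (α ⊕ b) → ℝ => (smoothNorm δ (fieldVec v θ x k))⁻¹) := by
  refine ⟨((continuous_smoothNorm δ).comp (continuous_fieldVec v θ k)).inv₀
    fun _ => (smoothNorm_pos hδ _).ne', δ⁻¹, fun x => ?_⟩
  rw [abs_inv, abs_of_pos (smoothNorm_pos hδ _)]
  exact inv_anti₀ hδ (le_smoothNorm δ _)

lemma isBddCont_gibbs_fieldVal [Fintype κ] [Nonempty κ] (β δ : ℝ) (v : κ → b → ℝ) (θ : ℝ) (k : κ) :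
    IsBddCont (fun x : (α × b) ⊕ (α ⊕ b) → ℝ => gibbs β (fieldVal δ v θ x) k) :=
  ⟨(continuous_gibbs β k).comp (continuous_fieldVal δ v θ), 1, fun x => by
    rw [abs_of_nonneg (gibbs_nonneg _ _ _)]; exact gibbs_le_one _ _ _⟩

lemma hasDerivAt_fieldVal_line (hδ : 0 < δ) (v : κ → b → ℝ) (θ : ℝ)
    (x u : (α × b) ⊕ (α ⊕ b) → ℝ) (k : κ) :
    HasDerivAt (fun s : ℝ => fieldVal δ v θ (x + s • u) k) (fieldValDeriv δ v θ x u k) 0 := by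
  have h := HasDerivAt.smoothNorm hδ (hasDerivAt_fieldVec_line v θ x u k)
  simp only [zero_smul, add_zero] at h
  refine h.sub ?_
  refine HasDerivAt.const_mul _ (HasDerivAt.fun_sum fun j _ => HasDerivAt.mul_const ?_ _)
  simpa using ((hasDerivAt_id (0 : ℝ)).mul_const (u (.inr (.inr j)))).const_add
    (x (.inr (.inr j)))

lemma hasDerivAt_fieldDir_line (hδ : 0 < δ) (v : κ → b → ℝ) (θ : ℝ)
    (x u : (α × b) ⊕ (α ⊕ b) → ℝ) (k : κ) (i : α) :
    HasDerivAt (fun s : ℝ => fieldDir δ v θ (x + s • u) k i)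
      ((fieldVec v θ u k i - fieldDir δ v θ x k i * ∑ j, fieldDir δ v θ x k j * fieldVec v θ u k j)
        * (smoothNorm δ (fieldVec v θ x k))⁻¹) 0 := by
  have h := HasDerivAt.div_smoothNorm hδ (hasDerivAt_fieldVec_line v θ x u k) i
  simp only [zero_smul, add_zero] at h
  exact h

lemma hasDerivAt_fieldVal_angle (hδ : 0 < δ) (v : κ → b → ℝ) (θ : ℝ)
    (x : (α × b) ⊕ (α ⊕ b) → ℝ) (k : κ) :
    HasDerivAt (fun s : ℝ => fieldVal δ v s x k)
      (∑ i, fieldDir δ v θ x k i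
        * (cos θ * ∑ j, x (.inl (i, j)) * v k j - sin θ * x (.inr (.inl i)))
        + sin θ * ∑ j, x (.inr (.inr j)) * v k j) θ :=
  ((HasDerivAt.smoothNorm hδ (hasDerivAt_fieldVec_angle v θ x k)).sub
    ((hasDerivAt_cos θ).mul_const _)).congr_deriv (by simp only [fieldDir]; ring)

section Single

variable [DecidableEq α] [DecidableEq b]

lemma fieldValDeriv_single_matrix (δ : ℝ) (v : κ → b → ℝ) (θ : ℝ) (x : (α × b) ⊕ (α ⊕ b) → ℝ)
    (i : α) (j : b) (k : κ) :
    fieldValDeriv δ v θ x (Pi.single (.inl (i, j)) 1) k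
      = fieldDir δ v θ x k i * (sin θ * v k j) := by
  simp [fieldValDeriv, fieldVec_single_matrix]

lemma fieldValDeriv_single_left (δ : ℝ) (v : κ → b → ℝ) (θ : ℝ) (x : (α × b) ⊕ (α ⊕ b) → ℝ)
    (i : α) (k : κ) :
    fieldValDeriv δ v θ x (Pi.single (.inr (.inl i)) 1) k = fieldDir δ v θ x k i * cos θ := by
  simp [fieldValDeriv, fieldVec_single_left]

lemma fieldValDeriv_single_right (δ : ℝ) (v : κ → b → ℝ) (θ : ℝ) (x : (α × b) ⊕ (α ⊕ b) → ℝ)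
    (j : b) (k : κ) :
    fieldValDeriv δ v θ x (Pi.single (.inr (.inr j)) 1) k = - (cos θ * v k j) := by
  simp [fieldValDeriv, fieldVec_single_right, Pi.single_apply]

end Single

end Field

/-! ### The sign of the derivative along the interpolation -/

section Algebra

variable {α b κ : Type*} [Fintype α] [Fintype b] [Fintype κ]

lemma abs_sum_mul_le_one {γ : Type*} [Fintype γ] {u w : γ → ℝ} (hu : ∑ i, u i ^ 2 ≤ 1)
    (hw : ∑ i, w i ^ 2 ≤ 1) : |∑ i, u i * w i| ≤ 1 := by
  rw [← sq_le_one_iff_abs_le_one]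
  exact (Finset.sum_mul_sq_le_sq_mul_sq _ _ _).trans
    (mul_le_one₀ hu (by positivity) hw)

/-- The sign of the bracket in Gordon's comparison argument. -/
lemma gordon_bracket_nonneg {p : κ → ℝ} (hp : ∀ k, 0 ≤ p k) (hp1 : ∑ k, p k = 1)
    {V Q : κ → κ → ℝ} (hV : ∀ k l, |V k l| ≤ 1) (hQ : ∀ k l, |Q k l| ≤ 1) :
    0 ≤ ∑ k, p k * ((1 - ∑ l, p l * V k l) - (∑ l, p l * Q k l) + ∑ l, p l * (V k l * Q k l)) := by
  refine Finset.sum_nonneg fun k _ => mul_nonneg (hp k) ?_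
  have : (1 - ∑ l, p l * V k l) - (∑ l, p l * Q k l) + ∑ l, p l * (V k l * Q k l)
      = ∑ l, p l * ((1 - V k l) * (1 - Q k l)) := by
    have e : ∑ l, p l - (∑ l, p l * V k l) - (∑ l, p l * Q k l) + ∑ l, p l * (V k l * Q k l)
        = ∑ l, p l * ((1 - V k l) * (1 - Q k l)) := by
      rw [← Finset.sum_sub_distrib, ← Finset.sum_sub_distrib, ← Finset.sum_add_distrib]
      exact Finset.sum_congr rfl fun l _ => by ring
    rwa [hp1] at e
  rw [this]
  exact Finset.sum_nonneg fun l _ => mul_nonneg (hp l)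
    (mul_nonneg (by linarith [(abs_le.1 (hV k l)).2]) (by linarith [(abs_le.1 (hQ k l)).2]))

/-- Controls the contribution of the weight's own derivative, a double average with Gibbs weights at
two different angles. -/
lemma sum_mul_sum_mul_le_one {p q : κ → ℝ} (hp : ∀ k, 0 ≤ p k) (hp1 : ∑ k, p k = 1)
    (hq : ∀ k, 0 ≤ q k) (hq1 : ∑ k, q k = 1) {R : κ → κ → ℝ} (hR : ∀ k l, |R k l| ≤ 1) :
    ∑ k, p k * ∑ l, q l * R k l ≤ 1 := by
  calc ∑ k, p k * ∑ l, q l * R k l ≤ ∑ k, p k * 1 := by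
        refine Finset.sum_le_sum fun k _ => mul_le_mul_of_nonneg_left ?_ (hp k)
        rw [← hq1]
        exact Finset.sum_le_sum fun l _ => by
          nlinarith [hq l, (abs_le.1 (hR k l)).2]
    _ = 1 := by simpa using hp1

lemma sum_contract (v : κ → b → ℝ) (q : κ → ℝ) (k : κ) :
    ∑ j, v k j * ∑ l, q l * v l j = ∑ l, q l * ∑ j, v k j * v l j := by
  simp_rw [Finset.mul_sum]
  rw [Finset.sum_comm]
  exact Finset.sum_congr rfl fun l _ => Finset.sum_congr rfl fun j _ => by ring

/-- Since `v k` is a unit vector, summing over `j` leaves the curvature factor `(1 - n k i ^ 2) * I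
k` without any trace of `v`; this is what lets it cancel against the contribution of `g`. -/
lemma gordon_matrix_term {γ : Type*} {v : κ → b → ℝ} (hv : ∀ k, ∑ j, v k j ^ 2 = 1)
    (p p1 : κ → ℝ) (n n1 : κ → γ → ℝ) (I : κ → ℝ) (F lam β s : ℝ) (k : κ) (i : γ) :
    ∑ j, v k j * (-lam * F * (∑ l, p1 l * (n1 l i * v l j)) * (p k * n k i)
      + F * ((-β * p k * (n k i * (s * v k j) - ∑ l, p l * (n l i * (s * v l j)))) * n k i
        + p k * ((s * v k j - n k i * (n k i * (s * v k j))) * I k)))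
    = -lam * F * (p k * ∑ l, p1 l * (n k i * n1 l i * ∑ j, v k j * v l j))
      + s * F * p k * (-β * (n k i ^ 2 - ∑ l, p l * (n k i * n l i * ∑ j, v k j * v l j))
        + (1 - n k i ^ 2) * I k) := by
  have e1 := sum_contract v (fun l => p1 l * n1 l i) k
  have e2 := sum_contract v (fun l => p l * n l i) k
  have e3 : ∑ j, v k j * v k j = 1 := by simpa [sq] using hv k
  have f1 : ∑ l, p1 l * (n k i * n1 l i * ∑ j, v k j * v l j)
      = n k i * ∑ j, v k j * ∑ l, p1 l * n1 l i * v l j := by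
    rw [e1, Finset.mul_sum]; exact Finset.sum_congr rfl fun l _ => by ring
  have f2 : ∑ l, p l * (n k i * n l i * ∑ j, v k j * v l j)
      = n k i * ∑ j, v k j * ∑ l, p l * n l i * v l j := by
    rw [e2, Finset.mul_sum]; exact Finset.sum_congr rfl fun l _ => by ring
  have f3 : s * F * p k * (-β * (n k i ^ 2 - ∑ l, p l * (n k i * n l i * ∑ j, v k j * v l j))
        + (1 - n k i ^ 2) * I k)
      = s * F * p k * ((-β * n k i ^ 2 + (1 - n k i ^ 2) * I k) * (∑ j, v k j * v k j)
        + β * ∑ l, p l * (n k i * n l i * ∑ j, v k j * v l j)) := by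
    rw [e3]; ring
  have g1 : ∀ j, ∑ l, p1 l * (n1 l i * v l j) = ∑ l, p1 l * n1 l i * v l j := fun j =>
    Finset.sum_congr rfl fun l _ => by ring
  have g2 : ∀ j, ∑ l, p l * (n l i * (s * v l j)) = s * ∑ l, p l * n l i * v l j := fun j => by
    rw [Finset.mul_sum]; exact Finset.sum_congr rfl fun l _ => by ring
  rw [f3, f1, f2]
  simp_rw [g1, g2]
  obtain ⟨T1, hT1⟩ : ∃ T : b → ℝ, ∀ j, ∑ l, p1 l * n1 l i * v l j = T j := ⟨_, fun _ => rfl⟩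
  obtain ⟨T, hT⟩ : ∃ T : b → ℝ, ∀ j, ∑ l, p l * n l i * v l j = T j := ⟨_, fun _ => rfl⟩
  simp_rw [hT1, hT]
  simp only [Finset.mul_sum, ← Finset.sum_add_distrib]
  exact Finset.sum_congr rfl fun j _ => by ring

/-- The pointwise lower bound for the integrand of the derivative along the interpolation. -/
lemma gordon_pointwise {v : κ → b → ℝ} (hv : ∀ k, ∑ j, v k j ^ 2 = 1) {p p1 : κ → ℝ}
    (hp : ∀ k, 0 ≤ p k) (hp1 : ∑ k, p k = 1) (hq : ∀ k, 0 ≤ p1 k) (hq1 : ∑ k, p1 k = 1)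
    {n n1 : κ → α → ℝ} (hn : ∀ k, ∑ i, n k i ^ 2 ≤ 1) (hn1 : ∀ k, ∑ i, n1 k i ^ 2 ≤ 1)
    (I : κ → ℝ) {F lam β s c : ℝ} (hF : 0 ≤ F) (hlam : 0 ≤ lam) (hβ : 0 ≤ β) (hs : 0 ≤ s)
    (hc : 0 ≤ c) :
    -lam * c * F ≤
    ∑ k, ∑ i, ∑ j, c * v k j * (-lam * F * (∑ l, p1 l * (n1 l i * v l j)) * (p k * n k i)
      + F * ((-β * p k * (n k i * (s * v k j) - ∑ l, p l * (n l i * (s * v l j)))) * n k i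
        + p k * ((s * v k j - n k i * (n k i * (s * v k j))) * I k)))
    - ∑ k, ∑ i, s * (F * ((-β * p k * (n k i * c - ∑ l, p l * (n l i * c))) * n k i
        + p k * ((c - n k i * (n k i * c)) * I k)))
    + ∑ k, ∑ j, s * v k j * (F * (-β * p k * (-(c * v k j) - ∑ l, p l * -(c * v l j)))) := by
  set V : κ → κ → ℝ := fun k l => ∑ j, v k j * v l j with hVdef
  set Q : κ → κ → ℝ := fun k l => ∑ i, n k i * n l i with hQdef
  set R : κ → κ → ℝ := fun k l => V k l * ∑ i, n k i * n1 l i with hRdef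
  have hV : ∀ k l, |V k l| ≤ 1 := fun k l => abs_sum_mul_le_one (hv k).le (hv l).le
  have hQ : ∀ k l, |Q k l| ≤ 1 := fun k l => abs_sum_mul_le_one (hn k) (hn l)
  have hR : ∀ k l, |R k l| ≤ 1 := fun k l => by
    rw [hRdef, abs_mul]
    exact mul_le_one₀ (hV k l) (abs_nonneg _) (abs_sum_mul_le_one (hn k) (hn1 l))
  have hVk : ∀ k, V k k = 1 := fun k => by simpa [hVdef, sq] using hv k
  -- For each `k` everything collapses to the `lam`-term and a nonnegative multiple of the bracket
  -- in `gordon_bracket_nonneg`.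
  have key : ∀ k, (∑ i, ∑ j, c * v k j * (-lam * F * (∑ l, p1 l * (n1 l i * v l j)) * (p k * n k i)
      + F * ((-β * p k * (n k i * (s * v k j) - ∑ l, p l * (n l i * (s * v l j)))) * n k i
        + p k * ((s * v k j - n k i * (n k i * (s * v k j))) * I k))))
    - (∑ i, s * (F * ((-β * p k * (n k i * c - ∑ l, p l * (n l i * c))) * n k i
        + p k * ((c - n k i * (n k i * c)) * I k))))
    + (∑ j, s * v k j * (F * (-β * p k * (-(c * v k j) - ∑ l, p l * -(c * v l j)))))
    = -lam * c * F * (p k * ∑ l, p1 l * R k l)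
      + s * c * F * β * (p k * ((1 - ∑ l, p l * V k l) - (∑ l, p l * Q k l)
        + ∑ l, p l * (V k l * Q k l))) := by
    intro k
    have eM : ∀ i, ∑ j, c * v k j * (-lam * F * (∑ l, p1 l * (n1 l i * v l j)) * (p k * n k i)
        + F * ((-β * p k * (n k i * (s * v k j) - ∑ l, p l * (n l i * (s * v l j)))) * n k i
        + p k * ((s * v k j - n k i * (n k i * (s * v k j))) * I k)))
        = c * (-lam * F * (p k * ∑ l, p1 l * (n k i * n1 l i * V k l))
        + s * F * p k * (-β * (n k i ^ 2 - ∑ l, p l * (n k i * n l i * V k l))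
        + (1 - n k i ^ 2) * I k)) := fun i => by
      rw [← gordon_matrix_term hv p p1 n n1 I F lam β s k i, Finset.mul_sum]
      exact Finset.sum_congr rfl fun j _ => by ring
    have eh : ∑ j, s * v k j * (F * (-β * p k * (-(c * v k j) - ∑ l, p l * -(c * v l j))))
        = s * c * F * β * (p k * (1 - ∑ l, p l * V k l)) := by
      have := sum_contract v p k
      rw [← hVk k]
      change _ = s * c * F * β * (p k * (V k k - ∑ l, p l * ∑ j, v k j * v l j))
      rw [← this, hVdef, ← Finset.sum_sub_distrib, Finset.mul_sum, Finset.mul_sum]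
      refine Finset.sum_congr rfl fun j _ => ?_
      have : ∑ l, p l * -(c * v l j) = -c * ∑ l, p l * v l j := by
        rw [Finset.mul_sum]; exact Finset.sum_congr rfl fun l _ => by ring
      rw [this]; ring
    have eR : ∑ l, p1 l * R k l = ∑ i, ∑ l, p1 l * (n k i * n1 l i * V k l) := by
      rw [Finset.sum_comm]
      refine Finset.sum_congr rfl fun l _ => ?_
      simp only [hRdef, Finset.mul_sum]
      exact Finset.sum_congr rfl fun i _ => by ring
    have eVQ : ∑ l, p l * (V k l * Q k l) = ∑ i, ∑ l, p l * (n k i * n l i * V k l) := by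
      rw [Finset.sum_comm]
      refine Finset.sum_congr rfl fun l _ => ?_
      simp only [hQdef, Finset.mul_sum]
      exact Finset.sum_congr rfl fun i _ => by ring
    have eQ : ∑ l, p l * Q k l = ∑ i, n k i * ∑ l, p l * n l i := by
      simp only [hQdef, Finset.mul_sum]
      rw [Finset.sum_comm]
      exact Finset.sum_congr rfl fun i _ => Finset.sum_congr rfl fun l _ => by ring
    have eg : ∀ i, ∑ l, p l * (n l i * c) = c * ∑ l, p l * n l i := fun i => by
      rw [Finset.mul_sum]; exact Finset.sum_congr rfl fun l _ => by ring
    rw [eh, eR, eVQ, eQ]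
    simp_rw [eM, eg]
    -- The curvature terms with `I k` and the diagonal terms `n k i ^ 2` cancel between the matrix
    -- and `g`. Hence it suffices that the smoothed directions have norm at most one; the `1` in the
    -- bracket comes from `h`, through `V k k = 1`.
    have main : (∑ i, c * (-lam * F * (p k * ∑ l, p1 l * (n k i * n1 l i * V k l))
        + s * F * p k * (-β * (n k i ^ 2 - ∑ l, p l * (n k i * n l i * V k l))
        + (1 - n k i ^ 2) * I k)))
        - ∑ i, s * (F * ((-β * p k * (n k i * c - c * ∑ l, p l * n l i)) * n k i
        + p k * ((c - n k i * (n k i * c)) * I k)))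
        = -lam * c * F * (p k * ∑ i, ∑ l, p1 l * (n k i * n1 l i * V k l))
        + s * c * F * β * (p k * (-(∑ i, n k i * ∑ l, p l * n l i)
          + ∑ i, ∑ l, p l * (n k i * n l i * V k l))) := by
      rw [← Finset.sum_sub_distrib, ← Finset.sum_neg_distrib, ← Finset.sum_add_distrib,
        Finset.mul_sum, Finset.mul_sum, Finset.mul_sum, Finset.mul_sum,
        ← Finset.sum_add_distrib]
      exact Finset.sum_congr rfl fun i _ => by ring
    rw [main]; ring
  rw [← Finset.sum_sub_distrib, ← Finset.sum_add_distrib, Finset.sum_congr rfl fun k _ => key k,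
    Finset.sum_add_distrib, ← Finset.mul_sum, ← Finset.mul_sum]
  have h1 := sum_mul_sum_mul_le_one hp hp1 hq hq1 hR
  have h2 := gordon_bracket_nonneg hp hp1 hV hQ
  have h3 : 0 ≤ lam * c * F := by positivity
  have h4 : 0 ≤ s * c * F * β := by positivity
  nlinarith [mul_nonneg h4 h2, mul_le_mul_of_nonneg_left h1 h3]

end Algebra

/-! ### Stein's identity along the interpolation -/

section Interpolation

/-- Integrable functions with the same integral. -/
structure SameMean {X : Type*} [MeasurableSpace X] (μ : Measure X) (f g : X → ℝ) : Prop where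
  left : Integrable f μ
  right : Integrable g μ
  eq : ∫ x, f x ∂μ = ∫ x, g x ∂μ

namespace SameMean

variable {X : Type*} [MeasurableSpace X] {μ : Measure X} {f g f' g' : X → ℝ}

lemma const_mul (h : SameMean μ f g) (c : ℝ) :
    SameMean μ (fun x => c * f x) (fun x => c * g x) :=
  ⟨h.left.const_mul c, h.right.const_mul c, by rw [integral_const_mul, integral_const_mul, h.eq]⟩

lemma add (h : SameMean μ f g) (h' : SameMean μ f' g') :
    SameMean μ (fun x => f x + f' x) (fun x => g x + g' x) :=
  ⟨h.left.add h'.left, h.right.add h'.right, by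
    rw [integral_add h.left h'.left, integral_add h.right h'.right, h.eq, h'.eq]⟩

lemma sub (h : SameMean μ f g) (h' : SameMean μ f' g') :
    SameMean μ (fun x => f x - f' x) (fun x => g x - g' x) :=
  ⟨h.left.sub h'.left, h.right.sub h'.right, by
    rw [integral_sub h.left h'.left, integral_sub h.right h'.right, h.eq, h'.eq]⟩

lemma sum {γ : Type*} (s : Finset γ) {f g : γ → X → ℝ} (h : ∀ k, SameMean μ (f k) (g k)) :
    SameMean μ (fun x => ∑ k ∈ s, f k x) (fun x => ∑ k ∈ s, g k x) :=
  ⟨integrable_finsetSum _ fun k _ => (h k).left, integrable_finsetSum _ fun k _ => (h k).right, by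
    rw [integral_finsetSum _ fun k _ => (h k).left, integral_finsetSum _ fun k _ => (h k).right]
    exact Finset.sum_congr rfl fun k _ => (h k).eq⟩

lemma of_stein {ι : Type*} [Fintype ι] [DecidableEq ι] {f f' : (ι → ℝ) → ℝ} (c : ι)
    (hf : ∀ x, HasDerivAt (fun s : ℝ => f (x + s • Pi.single c 1)) (f' x) 0)
    (hi : IsBddCont f) (hi' : IsBddCont f') :
    SameMean (gaussPi ι) (fun x => x c * f x) f' :=
  ⟨hi.integrable_mul_apply c, hi'.integrable, integral_stein_of_isBddCont c hf hi hi'⟩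

end SameMean

variable {α b κ : Type*} [Fintype α] [Fintype b] [Fintype κ]
variable {δ β lam : ℝ} {v : κ → b → ℝ}

/-- The Laplace weight of the soft minimum over `k` of `‖M v k‖`. -/
def laplaceWeight (lam β δ : ℝ) (v : κ → b → ℝ) (x : (α × b) ⊕ (α ⊕ b) → ℝ) : ℝ :=
  rexp (-lam * softMin β (fieldVal δ v (π / 2) x))

lemma laplaceWeight_pos (lam β δ : ℝ) (v : κ → b → ℝ) (x : (α × b) ⊕ (α ⊕ b) → ℝ) :
    0 < laplaceWeight lam β δ v x := exp_pos _

/-- The integrand of the derivative along the interpolation. -/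
def interpDeriv (lam β δ : ℝ) (v : κ → b → ℝ) (θ : ℝ) (x : (α × b) ⊕ (α ⊕ b) → ℝ) : ℝ :=
  laplaceWeight lam β δ v x * ∑ k, gibbs β (fieldVal δ v θ x) k *
    (∑ i, fieldDir δ v θ x k i
        * (cos θ * ∑ j, x (.inl (i, j)) * v k j - sin θ * x (.inr (.inl i)))
        + sin θ * ∑ j, x (.inr (.inr j)) * v k j)

lemma interpDeriv_eq (lam β δ : ℝ) (v : κ → b → ℝ) (θ : ℝ) (x : (α × b) ⊕ (α ⊕ b) → ℝ) :
    interpDeriv lam β δ v θ x =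
    ∑ k, ∑ i, ∑ j, cos θ * v k j * (x (.inl (i, j)) * (laplaceWeight lam β δ v x
      * (gibbs β (fieldVal δ v θ x) k * fieldDir δ v θ x k i)))
    - ∑ k, ∑ i, sin θ * (x (.inr (.inl i)) * (laplaceWeight lam β δ v x
      * (gibbs β (fieldVal δ v θ x) k * fieldDir δ v θ x k i)))
    + ∑ k, ∑ j, sin θ * v k j * (x (.inr (.inr j)) * (laplaceWeight lam β δ v x
      * gibbs β (fieldVal δ v θ x) k)) := by
  rw [interpDeriv, ← Finset.sum_sub_distrib, ← Finset.sum_add_distrib, Finset.mul_sum]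
  refine Finset.sum_congr rfl fun k _ => ?_
  rw [← Finset.sum_sub_distrib, mul_add, mul_add]
  congr 1
  · rw [Finset.mul_sum, Finset.mul_sum]
    refine Finset.sum_congr rfl fun i _ => ?_
    rw [mul_sub, mul_sub, mul_sub]
    congr 1
    · simp only [Finset.mul_sum]
      exact Finset.sum_congr rfl fun j _ => by ring
    · ring
  · simp only [Finset.mul_sum]
    exact Finset.sum_congr rfl fun j _ => by ring

variable [Nonempty κ]

/-- At `θ = π / 2` the term with `h` disappears and the process is nonnegative. This makes the
Laplace weight bounded for `lam ≥ 0`. -/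
lemma le_softMin_fieldVal_pi_div_two (hδ : 0 < δ) (hβ : 0 < β) (v : κ → b → ℝ)
    (x : (α × b) ⊕ (α ⊕ b) → ℝ) :
    -(Real.log (Fintype.card κ) / β) ≤ softMin β (fieldVal δ v (π / 2) x) := by
  have := le_softMin hβ (a := fieldVal δ v (π / 2) x) (c := 0) fun k => by
    simpa [fieldVal] using (smoothNorm_pos hδ _).le
  linarith

lemma isBddCont_laplaceWeight (hδ : 0 < δ) (hβ : 0 < β) (hlam : 0 ≤ lam) (v : κ → b → ℝ) :
    IsBddCont (fun x : (α × b) ⊕ (α ⊕ b) → ℝ => laplaceWeight lam β δ v x) := by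
  refine ⟨((((continuous_softMin β).comp (continuous_fieldVal δ v (π / 2))).const_mul (-lam)).rexp),
    rexp (lam * (Real.log (Fintype.card κ) / β)), fun x => ?_⟩
  rw [abs_of_pos (laplaceWeight_pos _ _ _ _ _)]
  refine exp_le_exp.2 ?_
  nlinarith [le_softMin_fieldVal_pi_div_two hδ hβ v x]

lemma hasDerivAt_laplaceWeight_line (hδ : 0 < δ) (hβ : 0 < β) (lam : ℝ) (v : κ → b → ℝ)
    (x u : (α × b) ⊕ (α ⊕ b) → ℝ) :
    HasDerivAt (fun s : ℝ => laplaceWeight lam β δ v (x + s • u))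
      (-lam * laplaceWeight lam β δ v x * ∑ l, gibbs β (fieldVal δ v (π / 2) x) l
        * fieldValDeriv δ v (π / 2) x u l) 0 := by
  have h := ((HasDerivAt.softMin hβ (hasDerivAt_fieldVal_line hδ v (π / 2) x u)).const_mul
    (-lam)).exp
  simp only [zero_smul, add_zero] at h
  exact h.congr_deriv (by unfold laplaceWeight; ring)

lemma hasDerivAt_gibbs_line (hδ : 0 < δ) (β : ℝ) (v : κ → b → ℝ) (θ : ℝ)
    (x u : (α × b) ⊕ (α ⊕ b) → ℝ) (k : κ) :
    HasDerivAt (fun s : ℝ => gibbs β (fieldVal δ v θ (x + s • u)) k)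
      (-β * gibbs β (fieldVal δ v θ x) k * (fieldValDeriv δ v θ x u k
        - ∑ l, gibbs β (fieldVal δ v θ x) l * fieldValDeriv δ v θ x u l)) 0 := by
  have h := HasDerivAt.gibbs (β := β) (hasDerivAt_fieldVal_line hδ v θ x u) k
  simpa only [zero_smul, add_zero] using h

variable [DecidableEq α] [DecidableEq b]

/-- The term produced by Stein's identity for the matrix entry `(i, j)`. -/
def matrixTerm (lam β δ : ℝ) (v : κ → b → ℝ) (θ : ℝ) (k : κ) (i : α) (j : b)
    (x : (α × b) ⊕ (α ⊕ b) → ℝ) : ℝ :=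
    -lam * laplaceWeight lam β δ v x * (∑ l, gibbs β (fieldVal δ v (π / 2) x) l
        * (fieldDir δ v (π / 2) x l i * v l j))
      * (gibbs β (fieldVal δ v θ x) k * fieldDir δ v θ x k i)
    + laplaceWeight lam β δ v x * ((-β * gibbs β (fieldVal δ v θ x) k
      * (fieldDir δ v θ x k i * (sin θ * v k j)
        - ∑ l, gibbs β (fieldVal δ v θ x) l * (fieldDir δ v θ x l i * (sin θ * v l j))))
        * fieldDir δ v θ x k i
      + gibbs β (fieldVal δ v θ x) k * ((sin θ * v k j - fieldDir δ v θ x k i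
        * (fieldDir δ v θ x k i * (sin θ * v k j))) * (smoothNorm δ (fieldVec v θ x k))⁻¹))

/-- The term produced by Stein's identity for the coordinate `i` of `g`. -/
def leftTerm (lam β δ : ℝ) (v : κ → b → ℝ) (θ : ℝ) (k : κ) (i : α)
    (x : (α × b) ⊕ (α ⊕ b) → ℝ) : ℝ :=
    laplaceWeight lam β δ v x * ((-β * gibbs β (fieldVal δ v θ x) k
      * (fieldDir δ v θ x k i * cos θ
        - ∑ l, gibbs β (fieldVal δ v θ x) l * (fieldDir δ v θ x l i * cos θ)))
        * fieldDir δ v θ x k i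
      + gibbs β (fieldVal δ v θ x) k * ((cos θ - fieldDir δ v θ x k i
        * (fieldDir δ v θ x k i * cos θ)) * (smoothNorm δ (fieldVec v θ x k))⁻¹))

/-- The term produced by Stein's identity for the coordinate `j` of `h`. -/
def rightTerm (lam β δ : ℝ) (v : κ → b → ℝ) (θ : ℝ) (k : κ) (j : b)
    (x : (α × b) ⊕ (α ⊕ b) → ℝ) : ℝ :=
    laplaceWeight lam β δ v x * (-β * gibbs β (fieldVal δ v θ x) k
      * (-(cos θ * v k j) - ∑ l, gibbs β (fieldVal δ v θ x) l * -(cos θ * v l j)))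

/-- The endpoint weight depends on the matrix entries only, so this is the one case of the three in
which differentiating the weight contributes, producing the summand with `-lam`. -/
lemma stein_matrix_term (hδ : 0 < δ) (hβ : 0 < β) (hlam : 0 ≤ lam) (v : κ → b → ℝ) (θ : ℝ)
    (k : κ) (i : α) (j : b) :
    SameMean (gaussPi ((α × b) ⊕ (α ⊕ b)))
      (fun x => x (.inl (i, j)) * (laplaceWeight lam β δ v x
        * (gibbs β (fieldVal δ v θ x) k * fieldDir δ v θ x k i)))
      (matrixTerm (α := α) lam β δ v θ k i j) := by
  have bF := isBddCont_laplaceWeight (α := α) hδ hβ hlam v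
  have bp := fun θ k => isBddCont_gibbs_fieldVal (α := α) β δ v θ k
  have bn := fun θ k => isBddCont_fieldDir (α := α) (v := v) hδ θ k i
  have bI := isBddCont_inv_smoothNorm (α := α) (v := v) hδ θ k
  have hD : IsBddCont (matrixTerm (α := α) lam β δ v θ k i j) := by
    refine .add (.mul (.mul (.mul (.const _) bF) (.sum _ fun l => .mul (bp _ l)
      (.mul (bn _ l) (.const _)))) (.mul (bp θ k) (bn θ k)))
      (.mul bF (.add (.mul (.mul (.mul (.const _) (bp θ k)) (.sub (.mul (bn θ k) (.const _))
        (.sum _ fun l => .mul (bp θ l) (.mul (bn θ l) (.const _))))) (bn θ k))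
        (.mul (bp θ k) (.mul (.sub (.const _) (.mul (bn θ k) (.mul (bn θ k) (.const _)))) bI))))
  refine .of_stein _ (fun x => ?_) (bF.mul ((bp θ k).mul (bn θ k))) hD
  have h := (hasDerivAt_laplaceWeight_line hδ hβ lam v x (Pi.single (.inl (i, j)) 1)).mul
    ((hasDerivAt_gibbs_line hδ β v θ x (Pi.single (.inl (i, j)) 1) k).mul
      (hasDerivAt_fieldDir_line hδ v θ x (Pi.single (.inl (i, j)) 1) k i))
  refine h.congr_deriv ?_
  simp only [fieldValDeriv_single_matrix, fieldVec_single_matrix, sin_pi_div_two, one_mul,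
    zero_smul, add_zero, if_true, mul_ite, mul_zero, Finset.sum_ite_eq',
    Finset.mem_univ, Pi.mul_apply, matrixTerm]

/-- Because `cos (π / 2) = 0`, the weight is constant in `g` and its derivative drops out. -/
lemma stein_left_term (hδ : 0 < δ) (hβ : 0 < β) (hlam : 0 ≤ lam) (v : κ → b → ℝ) (θ : ℝ)
    (k : κ) (i : α) :
    SameMean (gaussPi ((α × b) ⊕ (α ⊕ b)))
      (fun x => x (.inr (.inl i)) * (laplaceWeight lam β δ v x
        * (gibbs β (fieldVal δ v θ x) k * fieldDir δ v θ x k i)))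
      (leftTerm (α := α) lam β δ v θ k i) := by
  have bF := isBddCont_laplaceWeight (α := α) hδ hβ hlam v
  have bp := fun k => isBddCont_gibbs_fieldVal (α := α) β δ v θ k
  have bn := fun k => isBddCont_fieldDir (α := α) (v := v) hδ θ k i
  have bI := isBddCont_inv_smoothNorm (α := α) (v := v) hδ θ k
  have hD : IsBddCont (leftTerm (α := α) lam β δ v θ k i) := by
    refine .mul bF (.add (.mul (.mul (.mul (.const _) (bp k)) (.sub (.mul (bn k) (.const _))
        (.sum _ fun l => .mul (bp l) (.mul (bn l) (.const _))))) (bn k))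
        (.mul (bp k) (.mul (.sub (.const _) (.mul (bn k) (.mul (bn k) (.const _)))) bI)))
  refine .of_stein _ (fun x => ?_) (bF.mul ((bp k).mul (bn k))) hD
  have h := (hasDerivAt_laplaceWeight_line hδ hβ lam v x (Pi.single (.inr (.inl i)) 1)).mul
    ((hasDerivAt_gibbs_line hδ β v θ x (Pi.single (.inr (.inl i)) 1) k).mul
      (hasDerivAt_fieldDir_line hδ v θ x (Pi.single (.inr (.inl i)) 1) k i))
  refine h.congr_deriv ?_
  simp only [fieldValDeriv_single_left, fieldVec_single_left, cos_pi_div_two,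
    zero_smul, add_zero, if_true, mul_ite, mul_zero, Finset.sum_ite_eq',
    Finset.mem_univ, Pi.mul_apply, Finset.sum_const_zero, zero_mul, zero_add, leftTerm]

lemma stein_right_term (hδ : 0 < δ) (hβ : 0 < β) (hlam : 0 ≤ lam) (v : κ → b → ℝ) (θ : ℝ)
    (k : κ) (j : b) :
    SameMean (gaussPi ((α × b) ⊕ (α ⊕ b)))
      (fun x => x (.inr (.inr j)) * (laplaceWeight lam β δ v x * gibbs β (fieldVal δ v θ x) k))
      (rightTerm (α := α) lam β δ v θ k j) := by
  have bF := isBddCont_laplaceWeight (α := α) hδ hβ hlam v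
  have bp := fun k => isBddCont_gibbs_fieldVal (α := α) β δ v θ k
  have hD : IsBddCont (rightTerm (α := α) lam β δ v θ k j) := by
    refine .mul bF (.mul (.mul (.const _) (bp k)) (.sub (.const _)
        (.sum _ fun l => .mul (bp l) (.const _))))
  refine .of_stein _ (fun x => ?_) (bF.mul (bp k)) hD
  have h := (hasDerivAt_laplaceWeight_line hδ hβ lam v x (Pi.single (.inr (.inr j)) 1)).mul
    (hasDerivAt_gibbs_line hδ β v θ x (Pi.single (.inr (.inr j)) 1) k)
  refine h.congr_deriv ?_
  simp only [fieldValDeriv_single_right, cos_pi_div_two,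
    zero_smul, add_zero, mul_zero, neg_zero, Finset.sum_const_zero, zero_mul, zero_add, rightTerm]

lemma integral_interpDeriv_ge (hδ : 0 < δ) (hβ : 0 < β) (hlam : 0 ≤ lam)
    (hv : ∀ k, ∑ j, v k j ^ 2 = 1) {θ : ℝ} (hs : 0 ≤ sin θ) (hc : 0 ≤ cos θ) :
    -lam * cos θ * ∫ x, laplaceWeight lam β δ v x ∂(gaussPi ((α × b) ⊕ (α ⊕ b)))
      ≤ ∫ x, interpDeriv lam β δ v θ x ∂(gaussPi ((α × b) ⊕ (α ⊕ b))) := by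
  have h := ((SameMean.sum Finset.univ fun k => .sum Finset.univ fun i => .sum Finset.univ fun j =>
      (stein_matrix_term (α := α) hδ hβ hlam v θ k i j).const_mul (cos θ * v k j)).sub
    (.sum Finset.univ fun k => .sum Finset.univ fun i =>
      (stein_left_term (α := α) hδ hβ hlam v θ k i).const_mul (sin θ))).add
    (.sum Finset.univ fun k => .sum Finset.univ fun j =>
      (stein_right_term (α := α) hδ hβ hlam v θ k j).const_mul (sin θ * v k j))
  simp_rw [interpDeriv_eq]
  rw [h.eq, ← integral_const_mul]
  refine integral_mono ((isBddCont_laplaceWeight hδ hβ hlam v).integrable.const_mul _) h.right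
    fun x => ?_
  exact gordon_pointwise hv (gibbs_nonneg _ _) (sum_gibbs _ _) (gibbs_nonneg _ _) (sum_gibbs _ _)
    (fun k => sum_sq_div_smoothNorm_le_one hδ _) (fun k => sum_sq_div_smoothNorm_le_one hδ _)
    (fun k => (smoothNorm δ (fieldVec v θ x k))⁻¹) (laplaceWeight_pos _ _ _ _ _).le hlam hβ.le hs hc

end Interpolation

/-! ### Gordon's comparison and the Laplace transform -/

section Gordon

variable {α b κ : Type*} [Fintype α] [Fintype b] [Fintype κ]
variable {δ β lam : ℝ} {v : κ → b → ℝ}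

omit [Fintype κ] in
lemma abs_entry_le_one (hv : ∀ k, ∑ j, v k j ^ 2 = 1) (k : κ) (j : b) : |v k j| ≤ 1 := by
  rw [← sq_le_one_iff_abs_le_one, ← hv k]
  exact Finset.single_le_sum (f := fun j => v k j ^ 2) (fun _ _ => sq_nonneg _) (Finset.mem_univ j)

omit [Fintype κ] in
lemma abs_sum_mul_entry_le (hv : ∀ k, ∑ j, v k j ^ 2 = 1) (k : κ) (y : b → ℝ) :
    |∑ j, y j * v k j| ≤ ∑ j, |y j| := by
  refine (Finset.abs_sum_le_sum_abs _ _).trans (Finset.sum_le_sum fun j _ => ?_)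
  rw [abs_mul]
  exact mul_le_of_le_one_right (abs_nonneg _) (abs_entry_le_one hv k j)

lemma sum_abs_field_eq (x : (α × b) ⊕ (α ⊕ b) → ℝ) :
    ∑ c, |x c| = ∑ i, (∑ j, |x (.inl (i, j))| + |x (.inr (.inl i))|) + ∑ j, |x (.inr (.inr j))| := by
  rw [Fintype.sum_sum_type, Fintype.sum_sum_type, Fintype.sum_prod_type, Finset.sum_add_distrib,
    add_assoc]

lemma abs_mul_add_mul_le {s c u w U W : ℝ} (hs : |s| ≤ 1) (hc : |c| ≤ 1) (hu : |u| ≤ U)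
    (hw : |w| ≤ W) : |s * u + c * w| ≤ U + W := by
  refine (abs_add_le _ _).trans (add_le_add ?_ ?_) <;> rw [abs_mul]
  · exact (mul_le_of_le_one_left (abs_nonneg _) hs).trans hu
  · exact (mul_le_of_le_one_left (abs_nonneg _) hc).trans hw

omit [Fintype κ] in
lemma abs_fieldVal_le (hδ : 0 < δ) (hv : ∀ k, ∑ j, v k j ^ 2 = 1) (θ : ℝ)
    (x : (α × b) ⊕ (α ⊕ b) → ℝ) (k : κ) : |fieldVal δ v θ x k| ≤ δ + ∑ c, |x c| := by
  have h1 : |smoothNorm δ (fieldVec v θ x k)|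
      ≤ δ + ∑ i, (∑ j, |x (.inl (i, j))| + |x (.inr (.inl i))|) := by
    rw [abs_of_pos (smoothNorm_pos hδ _)]
    refine (smoothNorm_le_add_sum hδ _).trans (add_le_add_right (Finset.sum_le_sum fun i _ => ?_) _)
    exact abs_mul_add_mul_le (abs_sin_le_one θ) (abs_cos_le_one θ)
      (abs_sum_mul_entry_le hv k _) le_rfl
  have h2 : |cos θ * ∑ j, x (.inr (.inr j)) * v k j| ≤ ∑ j, |x (.inr (.inr j))| := by
    rw [abs_mul]
    exact (mul_le_of_le_one_left (abs_nonneg _) (abs_cos_le_one θ)).trans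
      (abs_sum_mul_entry_le hv k _)
  rw [sum_abs_field_eq, ← add_assoc]
  exact (abs_sub _ _).trans (add_le_add h1 h2)

variable [Nonempty κ]

lemma abs_softMin_fieldVal_le (hδ : 0 < δ) (hβ : 0 < β) (hv : ∀ k, ∑ j, v k j ^ 2 = 1) (θ : ℝ)
    (x : (α × b) ⊕ (α ⊕ b) → ℝ) :
    |softMin β (fieldVal δ v θ x)| ≤ (Real.log (Fintype.card κ) / β + Fintype.card κ * δ)
      + Fintype.card κ * ∑ c, |x c| := by
  refine (abs_softMin_le hβ _).trans ?_
  have : ∑ k, |fieldVal δ v θ x k| ≤ Fintype.card κ * (δ + ∑ c, |x c|) := by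
    rw [← nsmul_eq_mul]
    exact Finset.sum_le_card_nsmul _ _ _ fun k _ => abs_fieldVal_le hδ hv θ x k
  linarith

lemma continuous_softMin_fieldVal (β δ : ℝ) (v : κ → b → ℝ) (θ : ℝ) :
    Continuous (fun x : (α × b) ⊕ (α ⊕ b) → ℝ => softMin β (fieldVal δ v θ x)) :=
  (continuous_softMin β).comp (continuous_fieldVal δ v θ)

lemma integrable_softMin_fieldVal (hδ : 0 < δ) (hβ : 0 < β) (hv : ∀ k, ∑ j, v k j ^ 2 = 1) (θ : ℝ) :
    Integrable (fun x => softMin β (fieldVal δ v θ x)) (gaussPi ((α × b) ⊕ (α ⊕ b))) :=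
  integrable_gaussPi_of_le (continuous_softMin_fieldVal β δ v θ).aestronglyMeasurable
    (abs_softMin_fieldVal_le hδ hβ hv θ)

lemma integrable_laplaceWeight_mul_softMin (hδ : 0 < δ) (hβ : 0 < β) (hlam : 0 ≤ lam)
    (hv : ∀ k, ∑ j, v k j ^ 2 = 1) (θ : ℝ) :
    Integrable (fun x => laplaceWeight lam β δ v x * softMin β (fieldVal δ v θ x))
      (gaussPi ((α × b) ⊕ (α ⊕ b))) := by
  obtain ⟨hc, C, hC⟩ := isBddCont_laplaceWeight (α := α) hδ hβ hlam v
  exact (integrable_softMin_fieldVal hδ hβ hv θ).bdd_mul hc.aestronglyMeasurable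
    (ae_of_all _ hC)

/-- The Gibbs weights sum to one and all direction entries, sines and cosines are at most one in
absolute value. The majorant is free of `θ`, as differentiation under the integral requires. -/
lemma abs_interpDeriv_le (hδ : 0 < δ) (hv : ∀ k, ∑ j, v k j ^ 2 = 1) (θ : ℝ)
    (x : (α × b) ⊕ (α ⊕ b) → ℝ) {C : ℝ} (hC : |laplaceWeight lam β δ v x| ≤ C) :
    |interpDeriv lam β δ v θ x| ≤ C * ∑ c, |x c| := by
  rw [interpDeriv, abs_mul]
  refine mul_le_mul hC ?_ (abs_nonneg _) ((abs_nonneg _).trans hC)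
  calc _ ≤ ∑ k, gibbs β (fieldVal δ v θ x) k * ∑ c, |x c| := by
        refine (Finset.abs_sum_le_sum_abs _ _).trans (Finset.sum_le_sum fun k _ => ?_)
        rw [abs_mul, abs_of_nonneg (gibbs_nonneg _ _ _)]
        refine mul_le_mul_of_nonneg_left ?_ (gibbs_nonneg _ _ _)
        rw [sum_abs_field_eq]
        refine (abs_add_le _ _).trans (add_le_add ?_ ?_)
        · refine (Finset.abs_sum_le_sum_abs _ _).trans (Finset.sum_le_sum fun i _ => ?_)
          rw [abs_mul]
          refine (mul_le_of_le_one_left (abs_nonneg _)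
            (abs_div_smoothNorm_le_one hδ _ i)).trans ?_
          rw [sub_eq_add_neg, ← neg_mul]
          exact abs_mul_add_mul_le (abs_cos_le_one θ) (by simpa using abs_sin_le_one θ)
            (abs_sum_mul_entry_le hv k _) le_rfl
        · rw [abs_mul]
          exact (mul_le_of_le_one_left (abs_nonneg _) (abs_sin_le_one θ)).trans
            (abs_sum_mul_entry_le hv k _)
    _ = ∑ c, |x c| := by rw [← Finset.sum_mul, sum_gibbs, one_mul]

lemma continuous_interpDeriv (hδ : 0 < δ) (hβ : 0 < β) (hlam : 0 ≤ lam) (v : κ → b → ℝ) (θ : ℝ) :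
    Continuous (fun x : (α × b) ⊕ (α ⊕ b) → ℝ => interpDeriv lam β δ v θ x) := by
  unfold interpDeriv
  refine (isBddCont_laplaceWeight hδ hβ hlam v).1.mul (continuous_finsetSum _ fun k _ =>
    (isBddCont_gibbs_fieldVal β δ v θ k).1.mul (.add (continuous_finsetSum _ fun i _ =>
      (isBddCont_fieldDir hδ θ k i).1.mul (by fun_prop)) (by fun_prop)))

lemma hasDerivAt_interp (hδ : 0 < δ) (hβ : 0 < β) (hlam : 0 ≤ lam)
    (hv : ∀ k, ∑ j, v k j ^ 2 = 1) (θ : ℝ) :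
    HasDerivAt (fun θ => ∫ x, laplaceWeight lam β δ v x * softMin β (fieldVal δ v θ x)
        ∂(gaussPi ((α × b) ⊕ (α ⊕ b))))
      (∫ x, interpDeriv lam β δ v θ x ∂(gaussPi ((α × b) ⊕ (α ⊕ b)))) θ := by
  obtain ⟨hc, C, hC⟩ := isBddCont_laplaceWeight (α := α) hδ hβ hlam v
  refine (hasDerivAt_integral_of_dominated_loc_of_deriv_le
    (F := fun θ x => laplaceWeight lam β δ v x * softMin β (fieldVal δ v θ x))
    (F' := fun θ x => interpDeriv lam β δ v θ x) (bound := fun x => C * ∑ c, |x c|)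
    univ_mem
    (Eventually.of_forall fun θ =>
      (integrable_laplaceWeight_mul_softMin hδ hβ hlam hv θ).aestronglyMeasurable)
    (integrable_laplaceWeight_mul_softMin hδ hβ hlam hv θ)
    (continuous_interpDeriv hδ hβ hlam v θ).aestronglyMeasurable
    (ae_of_all _ fun x θ _ => abs_interpDeriv_le hδ hv θ x (hC x))
    ((integrable_finsetSum _ fun c _ => (integrable_gaussPi_apply c).abs).const_mul _)
    (ae_of_all _ fun x θ _ => ?_)).2
  exact (HasDerivAt.softMin hβ (hasDerivAt_fieldVal_angle hδ v θ x)).const_mul _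

lemma integral_gaussPi_sum_mul {ι ι' : Type*} [Fintype ι] [Fintype ι'] (f : (ι → ℝ) → ℝ)
    (g : (ι' → ℝ) → ℝ) :
    ∫ x, f (fun i => x (.inl i)) * g (fun i => x (.inr i)) ∂(gaussPi (ι ⊕ ι'))
      = (∫ x, f x ∂(gaussPi ι)) * ∫ x, g x ∂(gaussPi ι') := by
  rw [← integral_prod_mul]
  exact (measurePreserving_sumPiEquivProdPi (fun _ : ι ⊕ ι' => gaussianReal 0 1)).integral_comp'
    (fun q : (ι → ℝ) × (ι' → ℝ) => f q.1 * g q.2)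

lemma measurePreserving_gaussPi_inl (ι ι' : Type*) [Fintype ι] [Fintype ι'] :
    MeasurePreserving (fun (x : ι ⊕ ι' → ℝ) i => x (.inl i)) (gaussPi (ι ⊕ ι')) (gaussPi ι) :=
  measurePreserving_fst.comp
    (measurePreserving_sumPiEquivProdPi (fun _ : ι ⊕ ι' => gaussianReal 0 1))

lemma measurePreserving_gaussPi_inr (ι ι' : Type*) [Fintype ι] [Fintype ι'] :
    MeasurePreserving (fun (x : ι ⊕ ι' → ℝ) i => x (.inr i)) (gaussPi (ι ⊕ ι')) (gaussPi ι') :=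
  measurePreserving_snd.comp
    (measurePreserving_sumPiEquivProdPi (fun _ : ι ⊕ ι' => gaussianReal 0 1))

-- The weight at `π / 2` sees only the matrix block and the process at `0` sees only `g` and `h`;
-- these blocks are independent.
omit [Nonempty κ] in
lemma integral_laplaceWeight_mul_softMin_zero (lam β δ : ℝ) (v : κ → b → ℝ) :
    ∫ x, laplaceWeight lam β δ v x * softMin β (fieldVal δ v 0 x) ∂(gaussPi ((α × b) ⊕ (α ⊕ b)))
      = (∫ x, laplaceWeight lam β δ v x ∂(gaussPi ((α × b) ⊕ (α ⊕ b))))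
        * ∫ x, softMin β (fieldVal δ v 0 x) ∂(gaussPi ((α × b) ⊕ (α ⊕ b))) := by
  have h1 : ∀ x : (α × b) ⊕ (α ⊕ b) → ℝ, laplaceWeight lam β δ v x
      = laplaceWeight lam β δ v (Sum.elim (fun i => x (.inl i)) 0) := fun x => by
    unfold laplaceWeight
    congr 3
    ext k
    simp only [fieldVal, cos_pi_div_two, zero_mul]
    congr 2
    ext i
    simp [fieldVec]
  have h2 : ∀ x : (α × b) ⊕ (α ⊕ b) → ℝ, softMin β (fieldVal δ v 0 x)
      = softMin β (fieldVal δ v 0 (Sum.elim 0 fun i => x (.inr i))) := fun x => by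
    congr 1
    ext k
    simp only [fieldVal, cos_zero, Sum.elim_inr]
    congr 2
    ext i
    simp [fieldVec]
  have h3 : ∀ x : (α × b) ⊕ (α ⊕ b) → ℝ,
      laplaceWeight lam β δ v x * softMin β (fieldVal δ v 0 x)
      = laplaceWeight lam β δ v (Sum.elim (fun i => x (.inl i)) 0)
        * softMin β (fieldVal δ v 0 (Sum.elim 0 fun i => x (.inr i))) := fun x => by
    rw [← h1, ← h2]
  rw [integral_congr_ae (ae_of_all _ h1), integral_congr_ae (ae_of_all _ h2),
    integral_congr_ae (ae_of_all _ h3)]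
  have e := integral_gaussPi_sum_mul (ι := α × b) (ι' := α ⊕ b)
  rw [e (fun y => laplaceWeight lam β δ v (Sum.elim y 0))
    (fun y => softMin β (fieldVal δ v 0 (Sum.elim 0 y)))]
  have e1 := e (fun y => laplaceWeight lam β δ v (Sum.elim y 0)) (fun _ => 1)
  have e2 := e (fun _ => 1) (fun y => softMin β (fieldVal δ v 0 (Sum.elim 0 y)))
  simp only [mul_one, one_mul, integral_const, probReal_univ, smul_eq_mul] at e1 e2
  rw [e1, e2]

/-- Gordon's comparison inequality, weighted by the Laplace transform. -/
lemma gordon_laplace (hδ : 0 < δ) (hβ : 0 < β) (hlam : 0 ≤ lam)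
    (hv : ∀ k, ∑ j, v k j ^ 2 = 1) :
    (∫ x, softMin β (fieldVal δ v 0 x) ∂(gaussPi ((α × b) ⊕ (α ⊕ b))) - lam)
        * ∫ x, laplaceWeight lam β δ v x ∂(gaussPi ((α × b) ⊕ (α ⊕ b)))
      ≤ ∫ x, laplaceWeight lam β δ v x * softMin β (fieldVal δ v (π / 2) x)
        ∂(gaussPi ((α × b) ⊕ (α ⊕ b))) := by
  classical
  set μ := gaussPi ((α × b) ⊕ (α ⊕ b))
  set L := ∫ x, laplaceWeight lam β δ v x ∂μ
  set Φ : ℝ → ℝ := fun θ => ∫ x, laplaceWeight lam β δ v x * softMin β (fieldVal δ v θ x) ∂μ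
  have hΦ : ∀ θ, HasDerivAt (fun θ => Φ θ + lam * L * sin θ)
      (∫ x, interpDeriv lam β δ v θ x ∂μ + lam * L * cos θ) θ := fun θ =>
    (hasDerivAt_interp hδ hβ hlam hv θ).add ((hasDerivAt_sin θ).const_mul _)
  -- The added term `lam * L * sin θ` compensates exactly for the possible decrease at rate `lam * L
  -- * cos θ`.
  have hmono : MonotoneOn (fun θ => Φ θ + lam * L * sin θ) (Icc 0 (π / 2)) := by
    refine monotoneOn_of_deriv_nonneg (convex_Icc _ _)
      (fun θ _ => (hΦ θ).continuousAt.continuousWithinAt)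
      (fun θ _ => (hΦ θ).differentiableAt.differentiableWithinAt) fun θ hθ => ?_
    rw [interior_Icc] at hθ
    rw [(hΦ θ).deriv]
    have := integral_interpDeriv_ge (α := α) hδ hβ hlam hv (θ := θ)
      (sin_nonneg_of_nonneg_of_le_pi hθ.1.le (by linarith [hθ.2, pi_pos]))
      (cos_nonneg_of_mem_Icc ⟨by linarith [hθ.1, pi_pos], hθ.2.le⟩)
    linarith
  have h := hmono (left_mem_Icc.2 (by positivity)) (right_mem_Icc.2 (by positivity))
    (by positivity : (0 : ℝ) ≤ π / 2)
  simp only [sin_zero, mul_zero, add_zero, sin_pi_div_two, mul_one] at h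
  have h0 : Φ 0 = L * ∫ x, softMin β (fieldVal δ v 0 x) ∂μ :=
    integral_laplaceWeight_mul_softMin_zero lam β δ v
  rw [h0] at h
  change _ ≤ Φ (π / 2)
  linarith

/-- The Laplace transform of the soft minimum is sub-Gaussian around Gordon's lower bound. -/
lemma integral_laplaceWeight_le (hδ : 0 < δ) (hβ : 0 < β) (hlam : 0 ≤ lam)
    (hv : ∀ k, ∑ j, v k j ^ 2 = 1) :
    ∫ x, laplaceWeight lam β δ v x ∂(gaussPi ((α × b) ⊕ (α ⊕ b)))
      ≤ rexp (lam ^ 2 / 2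
        - lam * ∫ x, softMin β (fieldVal δ v 0 x) ∂(gaussPi ((α × b) ⊕ (α ⊕ b)))) := by
  set μ := gaussPi ((α × b) ⊕ (α ⊕ b))
  set c := ∫ x, softMin β (fieldVal δ v 0 x) ∂μ
  set X : ((α × b) ⊕ (α ⊕ b) → ℝ) → ℝ := fun x => -softMin β (fieldVal δ v (π / 2) x) with hX
  have hW : ∀ t x, laplaceWeight t β δ v x = rexp (t * X x) := fun t x => by
    rw [laplaceWeight, hX]; ring_nf
  have hL : ∀ t, mgf X μ t = ∫ x, laplaceWeight t β δ v x ∂μ := fun t => by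
    simp_rw [hW]; rfl
  have hint : Ici 0 ⊆ integrableExpSet X μ := fun t ht => by
    have := (isBddCont_laplaceWeight (α := α) hδ hβ (mem_Ici.1 ht) v).integrable
    simp_rw [hW] at this
    exact this
  have hint' : ∀ t, 0 < t → t ∈ interior (integrableExpSet X μ) := fun t ht =>
    interior_mono hint (by rwa [interior_Ici])
  have hd : ∀ t, 0 < t → HasDerivAt (mgf X μ)
      (-∫ x, laplaceWeight t β δ v x * softMin β (fieldVal δ v (π / 2) x) ∂μ) t := fun t ht => by
    refine (hasDerivAt_mgf (hint' t ht)).congr_deriv ?_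
    rw [← integral_neg]
    refine integral_congr_ae (ae_of_all _ fun x => ?_)
    simp only [hW, hX]; ring
  -- Differentiability of the `mgf` is known only for `t > 0`, so the endpoint `0` is reached by
  -- continuity.
  have hcont : ContinuousOn (mgf X μ) (Icc 0 lam) := by
    refine continuousOn_of_dominated
      (bound := fun _ => rexp (lam * (Real.log (Fintype.card κ) / β)))
      (fun t ht => (hint ht.1).aestronglyMeasurable) (fun t ht => ae_of_all _ fun x => ?_)
      (integrable_const _) (ae_of_all _ fun x => by fun_prop)
    rw [norm_of_nonneg (exp_pos _).le]
    refine exp_le_exp.2 ?_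
    have h1 := le_softMin_fieldVal_pi_div_two hδ hβ v x
    have h2 : 0 ≤ Real.log (Fintype.card κ) / β := div_nonneg (log_natCast_nonneg _) hβ.le
    calc t * X x ≤ t * (Real.log (Fintype.card κ) / β) :=
          mul_le_mul_of_nonneg_left (by simp only [hX]; linarith) ht.1
      _ ≤ _ := mul_le_mul_of_nonneg_right ht.2 h2
  have hE : ∀ t, HasDerivAt (fun t => rexp (c * t - t ^ 2 / 2))
      (rexp (c * t - t ^ 2 / 2) * (c - t)) t := fun t => by
    have h1 : HasDerivAt (fun t : ℝ => c * t - t ^ 2 / 2) (c - t) t :=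
      (((hasDerivAt_id t).const_mul c).sub ((hasDerivAt_pow 2 t).div_const 2)).congr_deriv
        (by simp)
    exact h1.exp
  have hG : ∀ t, 0 < t → HasDerivAt (fun t => mgf X μ t * rexp (c * t - t ^ 2 / 2))
      ((-∫ x, laplaceWeight t β δ v x * softMin β (fieldVal δ v (π / 2) x) ∂μ)
        * rexp (c * t - t ^ 2 / 2) + mgf X μ t * (rexp (c * t - t ^ 2 / 2) * (c - t))) t :=
    fun t ht => (hd t ht).mul (hE t)
  -- `gordon_laplace` says `mgf' ≤ (t - c) * mgf`; the exponential is the integrating factor of this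
  -- inequality, and the product equals `1` at `t = 0`.
  have hanti : AntitoneOn (fun t => mgf X μ t * rexp (c * t - t ^ 2 / 2)) (Icc 0 lam) := by
    refine antitoneOn_of_deriv_nonpos (convex_Icc _ _) (hcont.mul (by fun_prop))
      (fun t ht => ?_) fun t ht => ?_
    · rw [interior_Icc] at ht
      exact (hG t ht.1).differentiableAt.differentiableWithinAt
    · rw [interior_Icc] at ht
      rw [(hG t ht.1).deriv]
      have := gordon_laplace (α := α) hδ hβ ht.1.le hv
      rw [← hL] at this
      have hp := exp_pos (c * t - t ^ 2 / 2)
      have : ((c - t) * mgf X μ t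
        - ∫ x, laplaceWeight t β δ v x * softMin β (fieldVal δ v (π / 2) x) ∂μ)
          * rexp (c * t - t ^ 2 / 2) ≤ 0 :=
        mul_nonpos_of_nonpos_of_nonneg (by linarith) hp.le
      linarith
  have h := hanti (left_mem_Icc.2 hlam) (right_mem_Icc.2 hlam) hlam
  simp only [mgf_zero, mul_zero, ne_eq, OfNat.ofNat_ne_zero, not_false_eq_true, zero_pow, zero_div,
    sub_zero, exp_zero, mul_one] at h
  rw [← hL, show lam ^ 2 / 2 - lam * c = -(c * lam - lam ^ 2 / 2) by ring, exp_neg]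
  rwa [← one_div, le_div_iff₀ (exp_pos _)]

/-- The lower tail of the soft minimum of `‖M v k‖`. -/
lemma measure_softMin_le (hδ : 0 < δ) (hβ : 0 < β) {a : ℝ} (ha : 0 ≤ a)
    (hv : ∀ k, ∑ j, v k j ^ 2 = 1) {r : ℝ}
    (hr : r + a ≤ ∫ x, softMin β (fieldVal δ v 0 x) ∂(gaussPi ((α × b) ⊕ (α ⊕ b)))) :
    (gaussPi ((α × b) ⊕ (α ⊕ b))).real {x | softMin β (fieldVal δ v (π / 2) x) ≤ r}
      ≤ rexp (-a ^ 2 / 2) := by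
  -- Chernoff's bound with parameter `a`: the exponent is at most `a * r + a ^ 2 / 2 - a * (r + a) =
  -- -a ^ 2 / 2`.
  have h := measure_le_le_exp_mul_mgf (μ := gaussPi ((α × b) ⊕ (α ⊕ b)))
    (X := fun x => softMin β (fieldVal δ v (π / 2) x)) (t := -a) r (by linarith)
    (isBddCont_laplaceWeight hδ hβ ha v).integrable
  refine h.trans ((mul_le_mul_of_nonneg_left
    (integral_laplaceWeight_le (α := α) hδ hβ ha hv) (exp_pos _).le).trans ?_)
  rw [← exp_add]
  exact exp_le_exp.2 (by nlinarith)

end Gordon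

/-! ### First moments of Gaussian linear forms -/

section GaussianMoments

lemma tendsto_gaussianPDFReal_std_atTop : Tendsto (gaussianPDFReal 0 1) atTop (𝓝 0) := by
  have h : gaussianPDFReal 0 1 = fun x => (√(2 * π))⁻¹ * rexp (-(x ^ 2 / 2)) := by
    ext x; simp [gaussianPDFReal, neg_div]
  rw [h, ← mul_zero (√(2 * π))⁻¹]
  refine Tendsto.const_mul _ (tendsto_exp_neg_atTop_nhds_zero.comp ?_)
  exact (tendsto_pow_atTop two_ne_zero).atTop_div_const two_pos

lemma integral_abs_gaussianReal_std : ∫ t, |t| ∂(gaussianReal 0 1) = √(2 / π) := by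
  have hi : Integrable (fun t => gaussianPDFReal 0 1 t * t) :=
    (integrable_gaussianReal_iff_std id).1 (memLp_one_iff_integrable.1 (memLp_id_gaussianReal 1))
  -- On the half line `t φ(t)` has antiderivative `-φ(t)`; evenness then doubles the value `φ(0)`.
  have h1 : ∫ t in Ioi (0 : ℝ), -t * gaussianPDFReal 0 1 t = 0 - gaussianPDFReal 0 1 0 :=
    integral_Ioi_of_hasDerivAt_of_tendsto' (fun t _ => hasDerivAt_gaussianPDFReal_std t)
      (hi.neg.congr (ae_of_all _ fun t => by simp; ring)).integrableOn
      tendsto_gaussianPDFReal_std_atTop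
  have h2 : gaussianPDFReal 0 1 0 = (√(2 * π))⁻¹ := by simp [gaussianPDFReal]
  have h3 : ∫ t in Ioi (0 : ℝ), t * gaussianPDFReal 0 1 t = (√(2 * π))⁻¹ := by
    have : ∫ t in Ioi (0 : ℝ), -(t * gaussianPDFReal 0 1 t) = -(√(2 * π))⁻¹ := by
      simpa [h2] using h1
    rw [integral_neg] at this
    linarith
  rw [integral_gaussianReal_eq_integral_smul one_ne_zero]
  have h4 := integral_comp_abs (f := fun t => t * gaussianPDFReal 0 1 t)
  have h5 : ∀ t, gaussianPDFReal 0 1 t • |t| = |t| * gaussianPDFReal 0 1 |t| := fun t => by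
    simp [gaussianPDFReal, mul_comm]
  simp_rw [h5, h4, h3]
  have : √(2 / π) = 2 * (√(2 * π))⁻¹ := by
    rw [← sqrt_inv, show (2 : ℝ) / π = 2 ^ 2 * (2 * π)⁻¹ by field_simp,
      sqrt_mul (by positivity), sqrt_sq two_pos.le]
  rw [this]

variable {b : Type*} [Fintype b]

/-- The linear form has law `N(0, ‖ω‖²)`, a standard normal scaled by `‖ω‖`. -/
lemma integral_abs_linear_gaussPi (ω : EuclideanSpace ℝ b) :
    ∫ x, |∑ j, x j * ω j| ∂(gaussPi b) = √(2 / π) * ‖ω‖ := by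
  have hm : (gaussPi b).map (fun x => ∑ j, x j * ω j) = gaussianReal 0 (‖ω‖₊ ^ 2) := by
    have h1 := IsGaussian.map_eq_gaussianReal (μ := stdGaussian (EuclideanSpace ℝ b))
      (innerSL ℝ ω)
    rw [integral_strongDual_stdGaussian, variance_dual_stdGaussian, ← map_pi_eq_stdGaussian,
      Measure.map_map (by fun_prop) (by fun_prop), innerSL_apply_norm] at h1
    convert h1 using 2
    · ext x
      simp [PiLp.inner_apply]
    · ext; simp
  have hs : gaussianReal 0 (‖ω‖₊ ^ 2) = (gaussianReal 0 1).map (‖ω‖ * ·) := by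
    rw [gaussianReal_map_const_mul]
    congr 1
    · simp
    · ext; simp
  have e1 : ∫ x, |∑ j, x j * ω j| ∂(gaussPi b) = ∫ t, |t| ∂(gaussianReal 0 (‖ω‖₊ ^ 2)) := by
    rw [← hm, integral_map (Continuous.measurable (by fun_prop)).aemeasurable (by fun_prop)]
  rw [e1, hs, integral_map (by fun_prop) (by fun_prop), ← integral_abs_gaussianReal_std,
    mul_comm, ← integral_const_mul]
  simp [abs_mul]

lemma integral_linear_gaussPi (ω : b → ℝ) : ∫ x, ∑ j, x j * ω j ∂(gaussPi b) = 0 := by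
  rw [integral_finsetSum _ fun j _ => (integrable_gaussPi_apply j).mul_const _]
  refine Finset.sum_eq_zero fun j _ => ?_
  classical
  have h := integral_stein_of_isBddCont j (f := fun _ => 1) (f' := fun _ => 0)
    (fun x => hasDerivAt_const _ _) (.const 1) (.const 0)
  simp only [mul_one, integral_zero] at h
  rw [integral_mul_const, h, zero_mul]

end GaussianMoments

/-! ### The expected norm of a Gaussian vector -/

section ExpectedNorm

variable {α : Type*} [Fintype α] {δ : ℝ}

lemma memLp_two_smoothNorm (hδ : 0 < δ) : MemLp (smoothNorm δ) 2 (gaussPi α) :=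
  memLp_two_gaussPi_of_le (continuous_smoothNorm δ).aestronglyMeasurable (C := δ) (D := 1)
    fun x => by
      rw [abs_of_pos (smoothNorm_pos hδ x), one_mul]; exact smoothNorm_le_add_sum hδ x

lemma integrable_smoothNorm (hδ : 0 < δ) : Integrable (smoothNorm δ) (gaussPi α) :=
  (memLp_two_smoothNorm hδ).integrable (by norm_num)

lemma integrable_sq_mul_smoothNorm (hδ : 0 < δ) (i : α) :
    Integrable (fun x : α → ℝ => x i * (x i * smoothNorm δ x)) (gaussPi α) := by
  have h4 : Integrable (fun x : α → ℝ => x i ^ 4) (gaussPi α) := by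
    have := (by simpa using memLp_gaussPi_apply i 4 :
      MemLp (fun x : α → ℝ => x i) 4 (gaussPi α)).integrable_norm_pow (p := 4) (by norm_num)
    simpa [Even.pow_abs (show Even 4 by decide)] using this
  have h2 := (memLp_two_smoothNorm (α := α) hδ).integrable_sq
  refine (h4.add h2).mono' (by fun_prop) (ae_of_all _ fun x => ?_)
  simp only [norm_eq_abs, Pi.add_apply]
  rw [← mul_assoc, abs_mul, abs_of_nonneg (mul_self_nonneg _), abs_of_pos (smoothNorm_pos hδ x)]
  nlinarith [sq_nonneg (x i ^ 2 - smoothNorm δ x), sq_nonneg (x i ^ 2), sq_nonneg (smoothNorm δ x)]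

lemma integral_sq_mul_smoothNorm (hδ : 0 < δ) (i : α) :
    ∫ x, x i * (x i * smoothNorm δ x) ∂(gaussPi α)
      = ∫ x, (smoothNorm δ x + x i * (x i / smoothNorm δ x)) ∂(gaussPi α) := by
  classical
  refine integral_stein_pi i (fun x => ?_) ?_ ?_ (integrable_sq_mul_smoothNorm hδ i)
  · have hx : ∀ j, HasDerivAt (fun s : ℝ => (x + s • (Pi.single i 1 : α → ℝ)) j)
        ((Pi.single i 1 : α → ℝ) j) 0 := fun j => by
      simpa using ((hasDerivAt_id (0 : ℝ)).mul_const ((Pi.single i 1 : α → ℝ) j)).const_add (x j)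
    refine ((hx i).mul (HasDerivAt.smoothNorm hδ hx)).congr_deriv ?_
    simp [Pi.single_apply]
  · exact ((by simpa using memLp_gaussPi_apply i 2 :
      MemLp (fun x : α → ℝ => x i) 2 (gaussPi α)).integrable_mul (memLp_two_smoothNorm hδ))
  · refine integrable_gaussPi_of_le (C := δ) (D := 2) ?_ fun x => ?_
    · exact (Continuous.add (by fun_prop) ((continuous_apply i).mul ((continuous_apply i).div
        (by fun_prop) fun x => (smoothNorm_pos hδ x).ne'))).aestronglyMeasurable
    · refine (abs_add_le _ _).trans ?_
      rw [abs_of_pos (smoothNorm_pos hδ x), abs_mul]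
      have h1 := smoothNorm_le_add_sum hδ x
      have h2 := mul_le_of_le_one_right (abs_nonneg (x i)) (abs_div_smoothNorm_le_one hδ x i)
      have h3 := Finset.single_le_sum (f := fun c => |x c|) (fun _ _ => abs_nonneg _)
        (Finset.mem_univ i)
      linarith

/-- The classical lower bound for the expected norm of a standard Gaussian vector. -/
lemma le_integral_smoothNorm (hδ : 0 < δ) :
    (Fintype.card α : ℝ) / √(Fintype.card α + 1) ≤ ∫ x, smoothNorm δ x ∂(gaussPi α) := by
  set m : ℝ := (Fintype.card α : ℝ)
  set E := ∫ x, smoothNorm δ x ∂(gaussPi α)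
  set s := √(m + 1)
  have hm : 0 ≤ m := Nat.cast_nonneg _
  have hs : s ^ 2 = m + 1 := sq_sqrt (by positivity)
  have hs0 : 0 < s := sqrt_pos.2 (by positivity)
  have isq : ∀ i : α, Integrable (fun x : α → ℝ => x i ^ 2) (gaussPi α) := fun i =>
    (by simpa using memLp_gaussPi_apply i 2 :
      MemLp (fun x : α → ℝ => x i) 2 (gaussPi α)).integrable_sq
  have iN := integrable_smoothNorm (α := α) hδ
  have iq := fun i : α => integrable_sq_mul_smoothNorm hδ i
  -- Summed over `i`, Stein's identity gives `m * E` plus the mean of `‖x‖² / smoothNorm`, which is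
  -- at most `E`.
  have h1 : ∑ i, ∫ x, x i * (x i * smoothNorm δ x) ∂(gaussPi α) ≤ (m + 1) * E := by
    simp_rw [integral_sq_mul_smoothNorm hδ]
    have iD : ∀ i : α, Integrable (fun x : α → ℝ => x i * (x i / smoothNorm δ x)) (gaussPi α) :=
      fun i => IsBddCont.integrable_mul_apply ⟨(continuous_apply i).div (by fun_prop)
        fun x => (smoothNorm_pos hδ x).ne', 1, fun x => abs_div_smoothNorm_le_one hδ x i⟩ i
    rw [Finset.sum_congr rfl fun i _ => integral_add iN (iD i), Finset.sum_add_distrib,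
      ← integral_finsetSum _ fun i _ => iD i]
    have : ∫ x, ∑ i, x i * (x i / smoothNorm δ x) ∂(gaussPi α) ≤ E := by
      refine integral_mono (integrable_finsetSum _ fun i _ => iD i) iN fun x => ?_
      have hp := smoothNorm_pos hδ x
      simp_rw [← mul_div_assoc, ← Finset.sum_div]
      rw [div_le_iff₀ hp, ← sq, smoothNorm_sq]
      simp_rw [← sq]
      nlinarith
    simp only [Finset.sum_const, Finset.card_univ, nsmul_eq_mul]
    change m * E + _ ≤ _
    linarith
  -- Pointwise `2 s q² ≤ q (s² + q²)` with `q = ‖x‖`. The value `s = √(m + 1)` balances the two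
  -- terms, so that `2 s m ≤ 2 s² E`.
  have h2 : ∫ x, 2 * s * ∑ i, x i ^ 2 ∂(gaussPi α)
      ≤ ∫ x, (s ^ 2 * smoothNorm δ x + ∑ i, x i * (x i * smoothNorm δ x)) ∂(gaussPi α) := by
    refine integral_mono ((integrable_finsetSum _ fun i _ => isq i).const_mul _)
      ((iN.const_mul _).add (integrable_finsetSum _ fun i _ => iq i)) fun x => ?_
    have e : ∑ i, x i * (x i * smoothNorm δ x) = (∑ i, x i ^ 2) * smoothNorm δ x := by
      rw [Finset.sum_mul]; exact Finset.sum_congr rfl fun i _ => by ring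
    simp only [e]
    have hR : 0 ≤ ∑ i, x i ^ 2 := by positivity
    have hq := sq_sqrt hR
    have hq0 := sqrt_nonneg (∑ i, x i ^ 2)
    have hN : √(∑ i, x i ^ 2) ≤ smoothNorm δ x := sqrt_le_sqrt (by nlinarith)
    rw [← hq]
    generalize √(∑ i, x i ^ 2) = q at *
    have : 2 * s * q ^ 2 ≤ q * (s ^ 2 + q ^ 2) := by nlinarith [mul_nonneg hq0 (sq_nonneg (s - q))]
    have : q * (s ^ 2 + q ^ 2) ≤ smoothNorm δ x * (s ^ 2 + q ^ 2) :=
      mul_le_mul_of_nonneg_right hN (by positivity)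
    linarith
  rw [integral_const_mul, integral_finsetSum _ fun i _ => isq i,
    integral_add (iN.const_mul _) (integrable_finsetSum _ fun i _ => iq i), integral_const_mul,
    integral_finsetSum _ fun i _ => iq i] at h2
  simp only [integral_gaussPi_sq, Finset.sum_const, Finset.card_univ, nsmul_eq_mul, mul_one] at h2
  change 2 * s * m ≤ s ^ 2 * E + _ at h2
  rw [div_le_iff₀ hs0]
  rw [← hs] at h1
  have : s * m ≤ s * (E * s) := by nlinarith
  exact le_of_mul_le_mul_left this hs0

end ExpectedNorm

/-! ### Escape through the mesh for finite and countable families -/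

section Tail

variable {α b : Type*} [Fintype α] [Fintype b]

lemma integral_comp_measurePreserving {X Y : Type*} [MeasurableSpace X] [MeasurableSpace Y]
    {μ : Measure X} {ν : Measure Y} {f : X → Y} (hf : MeasurePreserving f μ ν) {g : Y → ℝ}
    (hg : Integrable g ν) : ∫ x, g (f x) ∂μ = ∫ y, g y ∂ν := by
  rw [← hf.map_eq, integral_map hf.aemeasurable (by rw [hf.map_eq]; exact hg.aestronglyMeasurable)]

/-- At `θ = 0` the process is the smoothed norm of `g` minus `⟪h, v⟫`, bounded below uniformly in
`k` by replacing `⟪h, v⟫` with `W h`. -/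
lemma le_integral_softMin_zero {κ : Type*} [Fintype κ] [Nonempty κ] {δ β : ℝ} (hδ : 0 < δ)
    (hβ : 0 < β) {v : κ → b → ℝ} (hv : ∀ k, ∑ j, v k j ^ 2 = 1) {W : (b → ℝ) → ℝ}
    (hWi : Integrable W (gaussPi b)) (hW : ∀ k h, ∑ j, h j * v k j ≤ W h) :
    (Fintype.card α : ℝ) / √(Fintype.card α + 1) - ∫ h, W h ∂(gaussPi b)
        - Real.log (Fintype.card κ) / β
      ≤ ∫ x, softMin β (fieldVal δ v 0 x) ∂(gaussPi ((α × b) ⊕ (α ⊕ b))) := by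
  have mr := measurePreserving_gaussPi_inr (α × b) (α ⊕ b)
  have m1 := (measurePreserving_gaussPi_inl α b).comp mr
  have m2 := (measurePreserving_gaussPi_inr α b).comp mr
  have iN := integrable_smoothNorm (α := α) hδ
  have i1 := m1.integrable_comp_of_integrable iN
  have i2 := m2.integrable_comp_of_integrable hWi
  have e1 := integral_comp_measurePreserving m1 iN
  have e2 := integral_comp_measurePreserving m2 hWi
  have hN := le_integral_smoothNorm (α := α) hδ
  have h := integral_mono ((i1.sub i2).sub (integrable_const (Real.log (Fintype.card κ) / β)))
    (integrable_softMin_fieldVal (α := α) hδ hβ hv 0) fun x => by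
      refine le_softMin hβ fun k => ?_
      have h1 : fieldVec v 0 x k = fun i => x (.inr (.inl i)) := by ext i; simp [fieldVec]
      simp only [fieldVal, cos_zero, one_mul, h1]
      exact sub_le_sub_left (hW k fun j => x (.inr (.inr j))) _
  rw [integral_sub' (i1.sub i2) (integrable_const _), integral_sub' i1 i2] at h
  simp only [Function.comp_def] at h e1 e2
  rw [e1, e2, integral_const, probReal_univ, one_smul] at h
  linarith

/-- **Gordon's escape through the mesh**, for a finite family of unit vectors. -/
theorem gordon_escape_finite {κ : Type*} [Fintype κ] [Nonempty κ] {v : κ → b → ℝ}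
    (hv : ∀ k, ∑ j, v k j ^ 2 = 1) {W : (b → ℝ) → ℝ}
    (hWi : Integrable W (gaussPi b)) (hW : ∀ k h, ∑ j, h j * v k j ≤ W h) {r a : ℝ} (ha : 0 < a)
    (hr : r + a + ∫ h, W h ∂(gaussPi b) ≤ (Fintype.card α : ℝ) / √(Fintype.card α + 1)) :
    (gaussPi (α × b)).real {x | ∃ k, √(∑ i, (∑ j, x (i, j) * v k j) ^ 2) < r}
      ≤ rexp (-a ^ 2 / 2) := by
  have ml := measurePreserving_gaussPi_inl (α × b) (α ⊕ b)
  have hmeas : MeasurableSet {x : α × b → ℝ | ∃ k, √(∑ i, (∑ j, x (i, j) * v k j) ^ 2) < r} := by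
    rw [ofPred_exists]
    refine .iUnion fun k => measurableSet_lt ?_ measurable_const
    exact Continuous.measurable (by fun_prop)
  rw [measureReal_def, ← ml.measure_preimage hmeas.nullMeasurableSet, ← measureReal_def]
  -- Half of the slack `e` pays for smoothing the norm (`δ = e / 2`) and half for the soft minimum;
  -- letting `e → 0` removes both.
  have key : ∀ e, e ∈ Ioo 0 a → (gaussPi ((α × b) ⊕ (α ⊕ b))).real
      ((fun (x : (α × b) ⊕ (α ⊕ b) → ℝ) i => x (.inl i)) ⁻¹'
        {x | ∃ k, √(∑ i, (∑ j, x (i, j) * v k j) ^ 2) < r}) ≤ rexp (-(a - e) ^ 2 / 2) := by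
    rintro e ⟨he, hea⟩
    have hlog : 0 ≤ Real.log (Fintype.card κ) := log_natCast_nonneg _
    -- The `+ 1` keeps `β` positive when the family has one member and the logarithm is zero.
    set β := 2 * (Real.log (Fintype.card κ) + 1) / e
    have hβ : 0 < β := by positivity
    have hβ2 : Real.log (Fintype.card κ) / β ≤ e / 2 := by
      rw [div_le_iff₀ hβ]
      have : e / 2 * β = Real.log (Fintype.card κ) + 1 := by simp only [β]; field_simp
      linarith
    have hδ : 0 < e / 2 := by positivity
    have h0 := le_integral_softMin_zero (α := α) hδ hβ hv hWi hW
    refine le_trans (measureReal_mono ?_) (measure_softMin_le (α := α) hδ hβ (a := a - e)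
      (by linarith) hv (r := r + e / 2) (by linarith))
    rintro x ⟨k, hk⟩
    refine (softMin_le hβ _ k).trans ?_
    have h1 := smoothNorm_le_add_sqrt hδ (fieldVec v (π / 2) x k)
    have h2 : ∀ i, fieldVec v (π / 2) x k i = ∑ j, x (.inl (i, j)) * v k j := fun i => by
      simp [fieldVec]
    simp_rw [h2] at h1
    simp only [fieldVal, cos_pi_div_two, zero_mul, sub_zero]
    linarith
  have hlim : Tendsto (fun e : ℝ => rexp (-(a - e) ^ 2 / 2)) (𝓝[>] 0) (𝓝 (rexp (-(a - 0) ^ 2 / 2))) :=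
    (Continuous.tendsto (by fun_prop) 0).mono_left nhdsWithin_le_nhds
  rw [sub_zero] at hlim
  exact ge_of_tendsto hlim (eventually_of_mem (Ioo_mem_nhdsGT ha) key)

/-- **Gordon's escape through the mesh**, for a sequence of unit vectors. -/
theorem gordon_escape_seq {v : ℕ → b → ℝ}
    (hv : ∀ k, ∑ j, v k j ^ 2 = 1) {W : (b → ℝ) → ℝ}
    (hWi : Integrable W (gaussPi b)) (hW : ∀ k h, ∑ j, h j * v k j ≤ W h) {r a : ℝ} (ha : 0 < a)
    (hr : r + a + ∫ h, W h ∂(gaussPi b) ≤ (Fintype.card α : ℝ) / √(Fintype.card α + 1)) :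
    gaussPi (α × b) {x | ∃ k, √(∑ i, (∑ j, x (i, j) * v k j) ^ 2) < r}
      ≤ ENNReal.ofReal (rexp (-a ^ 2 / 2)) := by
  -- The finite bound does not depend on the cardinality, so it passes to the increasing union by
  -- continuity from below.
  set s : ℕ → Set (α × b → ℝ) := fun n =>
    {x | ∃ k : Fin (n + 1), √(∑ i, (∑ j, x (i, j) * v k j) ^ 2) < r}
  have hs : {x : α × b → ℝ | ∃ k, √(∑ i, (∑ j, x (i, j) * v k j) ^ 2) < r} = ⋃ n, s n := by
    ext x
    simp only [mem_ofPred_eq, mem_iUnion, s]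
    exact ⟨fun ⟨k, hk⟩ => ⟨k, Fin.last k, by simpa using hk⟩, fun ⟨_, k, hk⟩ => ⟨k, hk⟩⟩
  have hmono : Monotone s := fun n n' hn x ⟨k, hk⟩ => ⟨Fin.castLE (by omega) k, by simpa using hk⟩
  rw [hs, hmono.measure_iUnion]
  refine iSup_le fun n => ?_
  rw [← ofReal_measureReal]
  exact ENNReal.ofReal_le_ofReal
    (gordon_escape_finite (v := fun k : Fin (n + 1) => v k) (fun k => hv k) hWi (fun k => hW k) ha hr)

end Tail

/-! ### The Gaussian width of the descent cone -/

section Width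

variable {p d : ℕ}

lemma matApply_apply {k n : ℕ} (Ω : Matrix (Fin k) (Fin n) ℝ) (z : EuclideanSpace ℝ (Fin n))
    (i : Fin k) : matApply Ω z i = ∑ j, Ω i j * z j := by
  simp [matApply, Matrix.mulVec, dotProduct]

lemma inner_matRow {k n : ℕ} (Ω : Matrix (Fin k) (Fin n) ℝ) (i : Fin k)
    (z : EuclideanSpace ℝ (Fin n)) : inner ℝ (matRow Ω i) z = matApply Ω z i := by
  rw [matApply_apply]
  simp [matRow, PiLp.inner_apply, mul_comm]

/-- The unit vectors in a closed cone that contains the descent cone of `z ↦ ‖Ω z‖₁` at `x`. -/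
def descentSphere (Ω : Matrix (Fin p) (Fin d) ℝ) (x : EuclideanSpace ℝ (Fin d)) :
    Set (EuclideanSpace ℝ (Fin d)) :=
  {v | ‖v‖ = 1 ∧ ∑ i ∈ cosupport Ω x, |matApply Ω v i|
    + ∑ i ∈ (cosupport Ω x)ᶜ, SignType.sign (matApply Ω x i) * matApply Ω v i ≤ 0}

/-- With `w = Ωᵀ σ` one has `‖w‖² = ⟪σ, Ω w⟫ ≤ ‖σ‖ ‖Ω w‖`. The frame bound controls `‖Ω w‖` by `√B
‖w‖`, and `‖σ‖² ≤ p`. -/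
lemma sum_sq_transpose_le {Ω : Matrix (Fin p) (Fin d) ℝ} {A B : ℝ}
    (hΩ : IsFrameWithBounds Ω A B) {σ : Fin p → ℝ} (hσ : ∀ i, |σ i| ≤ 1) :
    ∑ j, (∑ i, σ i * Ω i j) ^ 2 ≤ p * B := by
  set w : EuclideanSpace ℝ (Fin d) := WithLp.toLp 2 fun j => ∑ i, σ i * Ω i j with hw
  have hB : 0 < B := hΩ.lower_pos.trans_le hΩ.lower_le_upper
  have hn : ‖w‖ ^ 2 = ∑ j, (∑ i, σ i * Ω i j) ^ 2 := by
    rw [EuclideanSpace.real_norm_sq_eq]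
  have h1 : ‖w‖ ^ 2 = ∑ i, σ i * matApply Ω w i := by
    rw [hn]
    simp_rw [matApply_apply, Finset.mul_sum]
    rw [Finset.sum_comm]
    refine Finset.sum_congr rfl fun j _ => ?_
    rw [sq, Finset.sum_mul]
    exact Finset.sum_congr rfl fun i _ => by simp only [hw]; ring
  have h2 : ∑ i, matApply Ω w i ^ 2 ≤ B * ‖w‖ ^ 2 := by
    simpa [inner_matRow] using hΩ.upper_bound w
  have h3 : ∑ i, σ i ^ 2 ≤ p := by
    calc ∑ i, σ i ^ 2 ≤ ∑ _i : Fin p, (1 : ℝ) :=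
          Finset.sum_le_sum fun i _ => (sq_le_one_iff_abs_le_one _).2 (hσ i)
      _ = p := by simp
  have h4 : (‖w‖ ^ 2) ^ 2 ≤ (p * B) * ‖w‖ ^ 2 := by
    calc (‖w‖ ^ 2) ^ 2 = (∑ i, σ i * matApply Ω w i) ^ 2 := by rw [h1]
      _ ≤ (∑ i, σ i ^ 2) * ∑ i, matApply Ω w i ^ 2 := Finset.sum_mul_sq_le_sq_mul_sq _ _ _
      _ ≤ p * (B * ‖w‖ ^ 2) := mul_le_mul h3 h2 (by positivity) (by positivity)
      _ = _ := by ring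
  rw [← hn]
  rcases (sq_nonneg ‖w‖).eq_or_lt with h | h
  · rw [← h]; positivity
  · rw [sq (‖w‖ ^ 2)] at h4
    exact le_of_mul_le_mul_right h4 h

lemma abs_sign_le_one (t : ℝ) : |(SignType.sign t : ℝ)| ≤ 1 := by
  rcases lt_trichotomy t 0 with h | h | h <;> simp [h]

/-- An upper bound for the squared distance from `h` to `t` times a dual certificate. -/
def polarDistSq (Ω : Matrix (Fin p) (Fin d) ℝ) (B : ℝ) (x : EuclideanSpace ℝ (Fin d)) (t : ℝ)
    (h : Fin d → ℝ) : ℝ :=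
  ∑ j, h j ^ 2 - 2 * t * (∑ i ∈ cosupport Ω x, |∑ j, h j * Ω i j|
    + ∑ i ∈ (cosupport Ω x)ᶜ, SignType.sign (matApply Ω x i) * ∑ j, h j * Ω i j) + t ^ 2 * (p * B)

/-- `Ωᵀ σ` is polar to the cone when `σ` equals the sign of `Ω x` off the cosupport and has entries
in `[-1, 1]` on it. That freedom is used to align `σ` with `Ω h`. -/
lemma exists_dual_certificate {Ω : Matrix (Fin p) (Fin d) ℝ} {A B : ℝ}
    (hΩ : IsFrameWithBounds Ω A B) (x : EuclideanSpace ℝ (Fin d)) (t : ℝ) (h : Fin d → ℝ) :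
    ∃ w : Fin d → ℝ, (∀ v ∈ descentSphere Ω x, ∑ j, w j * v j ≤ 0) ∧
      ∑ j, (h j - t * w j) ^ 2 ≤ polarDistSq Ω B x t h := by
  set σ : Fin p → ℝ := fun i => if i ∈ cosupport Ω x then (SignType.sign (∑ j, h j * Ω i j) : ℝ)
    else SignType.sign (matApply Ω x i) with hσdef
  have hσ : ∀ i, |σ i| ≤ 1 := fun i => by
    simp only [hσdef]; split_ifs <;> exact abs_sign_le_one _
  have hsplit : ∀ f : Fin p → ℝ, ∑ i, σ i * f i
      = ∑ i ∈ cosupport Ω x, SignType.sign (∑ j, h j * Ω i j) * f i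
        + ∑ i ∈ (cosupport Ω x)ᶜ, SignType.sign (matApply Ω x i) * f i := fun f => by
    rw [← Finset.sum_add_sum_compl (cosupport Ω x)]
    congr 1
    · exact Finset.sum_congr rfl fun i hi => by simp only [hσdef, if_pos hi]
    · exact Finset.sum_congr rfl fun i hi => by
        simp only [hσdef, if_neg (Finset.mem_compl.1 hi)]
  set w : Fin d → ℝ := fun j => ∑ i, σ i * Ω i j
  have hwv : ∀ v ∈ descentSphere Ω x, ∑ j, w j * v j ≤ 0 := by
    rintro v ⟨-, hv2⟩
    have : ∑ j, w j * v j = ∑ i, σ i * matApply Ω v i := by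
      simp_rw [matApply_apply, Finset.mul_sum]
      rw [Finset.sum_comm]
      refine Finset.sum_congr rfl fun j _ => ?_
      rw [Finset.sum_mul]
      exact Finset.sum_congr rfl fun i _ => by ring
    rw [this, hsplit]
    refine le_trans (add_le_add_left (Finset.sum_le_sum fun i _ => ?_) _) hv2
    refine (le_abs_self _).trans ?_
    rw [abs_mul]
    exact mul_le_of_le_one_left (abs_nonneg _) (abs_sign_le_one _)
  have hhw : ∑ j, h j * w j = ∑ i ∈ cosupport Ω x, |∑ j, h j * Ω i j|
      + ∑ i ∈ (cosupport Ω x)ᶜ, SignType.sign (matApply Ω x i) * ∑ j, h j * Ω i j := by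
    have : ∑ j, h j * w j = ∑ i, σ i * ∑ j, h j * Ω i j := by
      simp_rw [w, Finset.mul_sum]
      rw [Finset.sum_comm]
      exact Finset.sum_congr rfl fun i _ => Finset.sum_congr rfl fun j _ => by ring
    rw [this, hsplit]
    simp_rw [sign_mul_self]
  have hww : ∑ j, w j ^ 2 ≤ p * B := sum_sq_transpose_le hΩ hσ
  have h2 : ∑ j, (h j - t * w j) ^ 2
      = ∑ j, h j ^ 2 - 2 * t * ∑ j, h j * w j + t ^ 2 * ∑ j, w j ^ 2 := by
    simp_rw [Finset.mul_sum]
    rw [← Finset.sum_sub_distrib, ← Finset.sum_add_distrib]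
    exact Finset.sum_congr rfl fun j _ => by ring
  refine ⟨w, hwv, ?_⟩
  rw [h2, hhw, polarDistSq]
  exact add_le_add_right (mul_le_mul_of_nonneg_left hww (sq_nonneg t)) _

lemma polarDistSq_nonneg {Ω : Matrix (Fin p) (Fin d) ℝ} {A B : ℝ}
    (hΩ : IsFrameWithBounds Ω A B) (x : EuclideanSpace ℝ (Fin d)) (t : ℝ) (h : Fin d → ℝ) :
    0 ≤ polarDistSq Ω B x t h := by
  obtain ⟨w, -, hw⟩ := exists_dual_certificate hΩ x t h
  exact le_trans (by positivity) hw

/-- Polarity of `w` gives `⟪h, v⟫ ≤ ⟪h - t w, v⟫`, and Cauchy–Schwarz with `‖v‖ = 1` finishes. -/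
lemma sum_mul_le_sqrt_polarDistSq {Ω : Matrix (Fin p) (Fin d) ℝ} {A B : ℝ}
    (hΩ : IsFrameWithBounds Ω A B) {x v : EuclideanSpace ℝ (Fin d)} (hv : v ∈ descentSphere Ω x)
    {t : ℝ} (ht : 0 ≤ t) (h : Fin d → ℝ) :
    ∑ j, h j * v j ≤ √(polarDistSq Ω B x t h) := by
  obtain ⟨w, hwv, hw⟩ := exists_dual_certificate hΩ x t h
  have hvv : ∑ j, v j ^ 2 = 1 := by rw [← EuclideanSpace.real_norm_sq_eq, hv.1, one_pow]
  have h1 : ∑ j, h j * v j ≤ ∑ j, (h j - t * w j) * v j := by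
    have : ∑ j, (h j - t * w j) * v j = ∑ j, h j * v j - t * ∑ j, w j * v j := by
      rw [Finset.mul_sum, ← Finset.sum_sub_distrib]
      exact Finset.sum_congr rfl fun j _ => by ring
    nlinarith [mul_nonneg ht (neg_nonneg.2 (hwv v hv))]
  refine h1.trans (le_sqrt_of_sq_le ((Finset.sum_mul_sq_le_sq_mul_sq _ _ _).trans ?_))
  rwa [hvv, mul_one]

/-- Off the cosupport the signs do not depend on `h`, so those linear forms are centred and vanish;
only the absolute values on the cosupport survive. -/
lemma hasMean_polarDistSq (Ω : Matrix (Fin p) (Fin d) ℝ) (B : ℝ)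
    (x : EuclideanSpace ℝ (Fin d)) (t : ℝ) :
    Integrable (polarDistSq Ω B x t) (gaussPi (Fin d)) ∧
    ∫ h, polarDistSq Ω B x t h ∂(gaussPi (Fin d))
      = d - 2 * t * (√(2 / π) * ∑ i ∈ cosupport Ω x, ‖matRow Ω i‖) + t ^ 2 * (p * B) := by
  have isq : ∀ j : Fin d, Integrable (fun h : Fin d → ℝ => h j ^ 2) (gaussPi (Fin d)) := fun j =>
    (by simpa using memLp_gaussPi_apply j 2 :
      MemLp (fun h : Fin d → ℝ => h j) 2 (gaussPi (Fin d))).integrable_sq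
  have il : ∀ i : Fin p, Integrable (fun h : Fin d → ℝ => ∑ j, h j * Ω i j) (gaussPi (Fin d)) :=
    fun i => integrable_finsetSum _ fun j _ => (integrable_gaussPi_apply j).mul_const _
  have i1 := integrable_finsetSum Finset.univ fun j _ => isq j
  have i2 := integrable_finsetSum (cosupport Ω x) fun i _ => (il i).abs
  have i3 := integrable_finsetSum (cosupport Ω x)ᶜ fun i _ =>
    (il i).const_mul (SignType.sign (matApply Ω x i) : ℝ)
  have i4 := (i2.add i3).const_mul (2 * t)
  refine ⟨(i1.sub i4).add (integrable_const _), ?_⟩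
  have h1 := integral_add (i1.sub i4) (integrable_const (t ^ 2 * (p * B)))
  have h2 := integral_sub i1 i4
  simp only [Pi.sub_apply, Pi.add_apply] at h1 h2
  rw [h2, integral_const_mul, integral_add i2 i3, integral_finsetSum _ fun j _ => isq j,
    integral_finsetSum _ fun i _ => (il i).abs, integral_finsetSum _ fun i _ => (il i).const_mul _]
    at h1
  refine h1.trans ?_
  have e1 : ∀ i, ∫ h, |∑ j, h j * Ω i j| ∂(gaussPi (Fin d)) = √(2 / π) * ‖matRow Ω i‖ := fun i =>
    integral_abs_linear_gaussPi (matRow Ω i)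
  simp_rw [integral_const_mul, integral_linear_gaussPi, e1, integral_gaussPi_sq]
  simp [Finset.mul_sum]

/-- Jensen's inequality for the square root, obtained by integrating `(√f - c)² ≥ 0` at the mean `c`
of `√f`. -/
lemma integral_sqrt_le {X : Type*} [MeasurableSpace X] {μ : Measure X} [IsProbabilityMeasure μ]
    {f : X → ℝ} (hf : Integrable f μ) (h0 : ∀ x, 0 ≤ f x) :
    Integrable (fun x => √(f x)) μ ∧ ∫ x, √(f x) ∂μ ≤ √(∫ x, f x ∂μ) := by
  have hi : Integrable (fun x => √(f x)) μ := by
    refine (hf.add (integrable_const 1)).mono'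
      (continuous_sqrt.comp_aestronglyMeasurable hf.aestronglyMeasurable) (ae_of_all _ fun x => ?_)
    rw [norm_of_nonneg (sqrt_nonneg _)]
    have := h0 x
    refine sqrt_le_iff.2 ⟨add_nonneg this zero_le_one, ?_⟩
    simp only [Pi.add_apply]
    nlinarith
  refine ⟨hi, le_sqrt_of_sq_le ?_⟩
  set c := ∫ x, √(f x) ∂μ
  have h : ∫ x, 2 * c * √(f x) ∂μ ≤ ∫ x, (f x + c ^ 2) ∂μ := by
    refine integral_mono (hi.const_mul _) (hf.add (integrable_const _)) fun x => ?_
    have := sq_sqrt (h0 x)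
    simp only
    nlinarith [sq_nonneg (√(f x) - c)]
  rw [integral_add hf (integrable_const _), integral_const_mul, integral_const, probReal_univ,
    one_smul] at h
  change 2 * c * c ≤ _ at h
  linarith

/-- The bound on the Gaussian width of the descent cone, in the form of an integrable majorant. -/
lemma exists_width_majorant {Ω : Matrix (Fin p) (Fin d) ℝ} {A B : ℝ}
    (hΩ : IsFrameWithBounds Ω A B) (x : EuclideanSpace ℝ (Fin d)) :
    ∃ W : (Fin d → ℝ) → ℝ, Integrable W (gaussPi (Fin d)) ∧
      (∀ v ∈ descentSphere Ω x, ∀ h, ∑ j, h j * v j ≤ W h) ∧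
      ∫ h, W h ∂(gaussPi (Fin d)) ≤
        √(d - 2 / π * ((∑ i ∈ cosupport Ω x, ‖matRow Ω i‖) ^ 2 / (p * B))) := by
  have hB : 0 < B := hΩ.lower_pos.trans_le hΩ.lower_le_upper
  set R := ∑ i ∈ cosupport Ω x, ‖matRow Ω i‖ with hR
  have hR0 : 0 ≤ R := Finset.sum_nonneg fun _ _ => norm_nonneg _
  -- The minimizer of the quadratic `t ↦ d - 2 t √(2 / π) R + t² p B`.
  set t := √(2 / π) * R / (p * B) with ht
  have ht0 : 0 ≤ t := by positivity
  obtain ⟨hi, hm⟩ := hasMean_polarDistSq Ω B x t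
  obtain ⟨hs, hle⟩ := integral_sqrt_le hi (polarDistSq_nonneg hΩ x t)
  refine ⟨_, hs, fun v hv h => sum_mul_le_sqrt_polarDistSq hΩ hv ht0 h, hle.trans ?_⟩
  refine sqrt_le_sqrt (le_of_eq ?_)
  rw [hm, ← hR]
  have hq : √(2 / π) ^ 2 = 2 / π := sq_sqrt (by positivity)
  -- For `p = 0` division by zero makes both `t` and the fraction zero, so the two sides agree.
  rcases Nat.eq_zero_or_pos p with hp | hp
  · subst hp; simp [ht]
  · have hp' : (0 : ℝ) < p := by exact_mod_cast hp
    obtain ⟨q, hqe⟩ : ∃ q, q = √(2 / π) := ⟨_, rfl⟩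
    rw [ht, ← hqe]
    rw [← hqe] at hq
    rw [← hq]
    field_simp
    ring

end Width

/-! ### Stable recovery and the Gaussian matrix -/

section Recovery

variable {p d m : ℕ}

lemma matApply_sub {k n : ℕ} (Ω : Matrix (Fin k) (Fin n) ℝ) (y z : EuclideanSpace ℝ (Fin n)) :
    matApply Ω (y - z) = matApply Ω y - matApply Ω z := by
  ext i; simp [matApply, Matrix.mulVec_sub]

lemma matApply_smul {k n : ℕ} (Ω : Matrix (Fin k) (Fin n) ℝ) (c : ℝ)
    (z : EuclideanSpace ℝ (Fin n)) : matApply Ω (c • z) = c • matApply Ω z := by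
  ext i; simp [matApply, Matrix.mulVec_smul]

@[fun_prop]
lemma continuous_matApply {k n : ℕ} (Ω : Matrix (Fin k) (Fin n) ℝ) : Continuous (matApply Ω) := by
  unfold matApply; fun_prop

lemma norm_matApply {k n : ℕ} (M : Matrix (Fin k) (Fin n) ℝ) (z : EuclideanSpace ℝ (Fin n)) :
    ‖matApply M z‖ = √(∑ i, (∑ j, M i j * z j) ^ 2) := by
  simp [EuclideanSpace.norm_eq, matApply_apply]

/-- The sign is a subgradient of the absolute value. -/
lemma sign_mul_sub_le (s t : ℝ) : (SignType.sign s : ℝ) * (t - s) ≤ |t| - |s| := by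
  rw [mul_sub, sign_mul_self]
  refine sub_le_sub_right ((le_abs_self _).trans ?_) _
  rw [abs_mul]
  exact mul_le_of_le_one_left (abs_nonneg _) (abs_sign_le_one _)

lemma normalize_sub_mem_descentSphere {Ω : Matrix (Fin p) (Fin d) ℝ}
    {x z : EuclideanSpace ℝ (Fin d)} (hz : l1Norm (matApply Ω z) ≤ l1Norm (matApply Ω x))
    (hne : z - x ≠ 0) : ‖z - x‖⁻¹ • (z - x) ∈ descentSphere Ω x := by
  have hn : 0 < ‖z - x‖ := norm_pos_iff.2 hne
  refine ⟨by rw [norm_smul, norm_inv, norm_norm, inv_mul_cancel₀ hn.ne'], ?_⟩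
  have h1 : ∑ i ∈ cosupport Ω x, |matApply Ω (z - x) i|
      + ∑ i ∈ (cosupport Ω x)ᶜ, SignType.sign (matApply Ω x i) * matApply Ω (z - x) i ≤ 0 := by
    refine le_trans ?_ (sub_nonpos.2 hz)
    unfold l1Norm
    rw [← Finset.sum_sub_distrib, ← Finset.sum_add_sum_compl (cosupport Ω x)]
    rw [matApply_sub]
    refine add_le_add (Finset.sum_le_sum fun i hi => ?_) (Finset.sum_le_sum fun i _ => ?_)
    · have : matApply Ω x i = 0 := by simpa [cosupport] using hi
      simp [this]
    · exact sign_mul_sub_le _ _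
  rw [matApply_smul]
  have h2 := mul_nonpos_of_nonneg_of_nonpos (inv_nonneg.2 hn.le) h1
  rw [mul_add, Finset.mul_sum, Finset.mul_sum] at h2
  refine le_of_eq_of_le (congrArg₂ (· + ·) (Finset.sum_congr rfl fun i _ => ?_)
    (Finset.sum_congr rfl fun i _ => ?_)) h2
  · rw [PiLp.smul_apply, smul_eq_mul, abs_mul, abs_of_pos (inv_pos.2 hn)]
  · rw [PiLp.smul_apply, smul_eq_mul]; ring

/-- Stable recovery from a lower bound on the descent cone. -/
lemma norm_sub_minimizer_le {Ω : Matrix (Fin p) (Fin d) ℝ} {M : Matrix (Fin m) (Fin d) ℝ}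
    {x xhat : EuclideanSpace ℝ (Fin d)} {w : EuclideanSpace ℝ (Fin m)} {η τ : ℝ} (hτ : 0 < τ)
    (hM : ∀ v ∈ descentSphere Ω x, τ ≤ ‖matApply M v‖) (hw : ‖w‖ ≤ η)
    (hx : IsAnalysisL1Minimizer Ω M (matApply M x + w) η xhat) : ‖x - xhat‖ ≤ 2 * η / τ := by
  have hη : 0 ≤ η := (norm_nonneg w).trans hw
  rw [norm_sub_rev]
  by_cases hne : xhat - x = 0
  · rw [hne, norm_zero]; positivity
  have hn : 0 < ‖xhat - x‖ := norm_pos_iff.2 hne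
  have h1 := hM _ (normalize_sub_mem_descentSphere (hx.2 x (by simpa using hw)) hne)
  rw [matApply_smul, norm_smul, norm_inv, norm_norm, inv_mul_eq_div, le_div_iff₀ hn] at h1
  -- Feasibility of `xhat` and the noise bound each contribute one `η`.
  have h2 : ‖matApply M (xhat - x)‖ ≤ η + η := by
    have : matApply M (xhat - x) = (matApply M xhat - (matApply M x + w)) + w := by
      rw [matApply_sub]; abel
    rw [this]
    exact (norm_add_le _ _).trans (add_le_add hx.1 hw)
  rw [le_div_iff₀ hτ]
  linarith

lemma IsGaussianMatrix.hasLaw_entries {S : Type*} [MeasurableSpace S] {P : Measure S}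
    [IsProbabilityMeasure P] {M : S → Matrix (Fin m) (Fin d) ℝ} (hM : IsGaussianMatrix P M) :
    HasLaw (fun s (ij : Fin m × Fin d) => M s ij.1 ij.2) (gaussPi (Fin m × Fin d)) P := by
  have hae : ∀ ij : Fin m × Fin d, AEMeasurable (fun s => M s ij.1 ij.2) P := fun ij =>
    (hM.hasLaw ij.1 ij.2).aemeasurable
  refine ⟨aemeasurable_pi_lambda _ hae, ?_⟩
  rw [(iIndepFun_iff_map_fun_eq_pi_map hae).1 hM.indep]
  congr 1
  ext ij : 1
  exact (hM.hasLaw ij.1 ij.2).map_eq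

/-- A Gaussian matrix is bounded below on a set of unit vectors of small Gaussian width. -/
lemma measure_exists_norm_matApply_lt {S : Type*} [MeasurableSpace S] {P : Measure S}
    [IsProbabilityMeasure P] {M : S → Matrix (Fin m) (Fin d) ℝ} (hM : IsGaussianMatrix P M)
    {D : Set (EuclideanSpace ℝ (Fin d))} (hD : ∀ v ∈ D, ‖v‖ = 1) {W : (Fin d → ℝ) → ℝ}
    (hWi : Integrable W (gaussPi (Fin d))) (hW : ∀ v ∈ D, ∀ h, ∑ j, h j * v j ≤ W h) {r a : ℝ}
    (ha : 0 < a) (hr : r + a + ∫ h, W h ∂(gaussPi (Fin d)) ≤ (m : ℝ) / √(m + 1)) :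
    P {s | ∃ v ∈ D, ‖matApply (M s) v‖ < r} ≤ ENNReal.ofReal (rexp (-a ^ 2 / 2)) := by
  rcases D.eq_empty_or_nonempty with rfl | hne
  · simp
  have : Nonempty D := hne.to_subtype
  -- A strict violation at some `v` is an open condition for fixed `M`, hence also occurs at a
  -- member of a countable dense sequence.
  set u : ℕ → D := TopologicalSpace.denseSeq D
  have hu : DenseRange u := TopologicalSpace.denseRange_denseSeq D
  have hunit : ∀ k, ∑ j, (u k : EuclideanSpace ℝ (Fin d)) j ^ 2 = 1 := fun k => by
    rw [← EuclideanSpace.real_norm_sq_eq, hD _ (u k).2, one_pow]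
  have key := gordon_escape_seq (α := Fin m) (v := fun k j => (u k : EuclideanSpace ℝ (Fin d)) j)
    hunit hWi (fun k h => hW _ (u k).2 h) ha (by simpa using hr)
  set B : Set (Fin m × Fin d → ℝ) :=
    {y | ∃ k, √(∑ i, (∑ j, y (i, j) * (u k : EuclideanSpace ℝ (Fin d)) j) ^ 2) < r}
  have hB : MeasurableSet B := by
    simp only [B, ofPred_exists]
    exact .iUnion fun k => measurableSet_lt (Continuous.measurable (by fun_prop)) measurable_const
  have hlaw := hM.hasLaw_entries
  have hPB : P ((fun s (ij : Fin m × Fin d) => M s ij.1 ij.2) ⁻¹' B) = gaussPi (Fin m × Fin d) B := by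
    rw [← hlaw.map_eq, Measure.map_apply_of_aemeasurable hlaw.aemeasurable hB]
  refine le_trans (measure_mono ?_) (hPB.le.trans key)
  rintro s ⟨v, hv, hlt⟩
  have hopen : IsOpen {v : D | ‖matApply (M s) v‖ < r} :=
    isOpen_lt (by fun_prop) continuous_const
  obtain ⟨k, hk⟩ := hu.exists_mem_open hopen ⟨⟨v, hv⟩, hlt⟩
  refine ⟨k, ?_⟩
  rw [mem_ofPred_eq, norm_matApply] at hk
  exact hk

end Recovery

end

/-! ### Assembly -/

theorem mainTheorem4 {d p m : ℕ} (Ω : Matrix (Fin p) (Fin d) ℝ) (A B : ℝ)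
    (hΩ : IsFrameWithBounds Ω A B)
    (x : EuclideanSpace ℝ (Fin d)) (Λ : Finset (Fin p)) (hΛ : cosupport Ω x = Λ)
    {S : Type*} [MeasurableSpace S] (P : Measure S) [IsProbabilityMeasure P]
    (M : S → Matrix (Fin m) (Fin d) ℝ) (hM : IsGaussianMatrix P M)
    (η ε τ : ℝ) (hε0 : 0 < ε) (hε1 : ε < 1) (hτ : 0 < τ)
    (hm : (m : ℝ) ^ 2 / ((m : ℝ) + 1) ≥
      (Real.sqrt ((d : ℝ) -
          2 / Real.pi * ((∑ i ∈ Λ, ‖matRow Ω i‖) ^ 2 / ((p : ℝ) * B)))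
        + Real.sqrt (2 * Real.log ε⁻¹) + τ) ^ 2) :
    ∃ E : Set S, MeasurableSet E ∧ P E ≥ ENNReal.ofReal (1 - ε) ∧
      ∀ s ∈ E, ∀ w : EuclideanSpace ℝ (Fin m), ‖w‖ ≤ η →
        ∀ xhat : EuclideanSpace ℝ (Fin d),
          IsAnalysisL1Minimizer Ω (M s) (matApply (M s) x + w) η xhat →
            ‖x - xhat‖ ≤ 2 * η / τ := by
  subst hΛ
  obtain ⟨W, hWi, hW, hWle⟩ := exists_width_majorant hΩ x
  set a := √(2 * Real.log ε⁻¹) with ha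
  have hlog : 0 < Real.log ε⁻¹ := Real.log_pos ((one_lt_inv₀ hε0).2 hε1)
  have ha0 : 0 < a := Real.sqrt_pos.2 (by positivity)
  -- The choice `a = √(2 ln ε⁻¹)` makes the tail bound exactly `ε`.
  have hexp : Real.exp (-a ^ 2 / 2) = ε := by
    rw [neg_div, ha, Real.sq_sqrt (by positivity), mul_div_cancel_left₀ _ two_ne_zero,
      Real.log_inv, neg_neg, Real.exp_log hε0]
  have hm1 : ((m : ℝ) / √(m + 1)) ^ 2 = (m : ℝ) ^ 2 / (m + 1) := by
    rw [div_pow, Real.sq_sqrt (by positivity)]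
  have hm2 := abs_le_of_sq_le_sq (hm1 ▸ hm) (by positivity)
  have hbad := measure_exists_norm_matApply_lt hM (D := descentSphere Ω x) (fun v hv => hv.1) hWi hW
    (r := τ) ha0 (by linarith [le_abs_self (√(d - 2 / Real.pi * ((∑ i ∈ cosupport Ω x, ‖matRow Ω i‖) ^ 2 / (p * B))) + a + τ)])
  rw [hexp] at hbad
  set N := {s | ∃ v ∈ descentSphere Ω x, ‖matApply (M s) v‖ < τ} with hN
  -- The bad set is an uncountable union and is not shown to be measurable; a measurable hull of
  -- equal measure replaces it.
  refine ⟨(toMeasurable P N)ᶜ, (measurableSet_toMeasurable P N).compl, ?_, ?_⟩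
  · rw [prob_compl_eq_one_sub (measurableSet_toMeasurable P N), measure_toMeasurable,
      ENNReal.ofReal_sub _ hε0.le, ENNReal.ofReal_one]
    exact tsub_le_tsub_left hbad _
  · intro s hs w hw xhat hx
    refine norm_sub_minimizer_le hτ (fun v hv => ?_) hw hx
    by_contra hlt
    exact hs (subset_toMeasurable P N ⟨v, hv, not_le.1 hlt⟩)
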